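/- Let $K$ be an algebraically closed field of characteristic $0$ and $B_3=\langle\sigma_1,\sigma_2\mid\sigma_1\sigma_2\sigma_1=\sigma_2\sigma_1\sigma_2\rangle$. A representation is called strictly indecomposable if it is indecomposable but not irreducible. Write $e^{\pm\pi i/3}$ (resp. $e^{\pm\pi i/2}$) for the two primitive sixth (resp. fourth) roots of unity in $K$. Let $\mathrm{J}$ be the following list of pairs $(A,B)$ of $3\times3$ matrices over $K$, where in each item the $\lambda_i$ (or $\lambda$) are nonzero and mutually different: (1) $A=\mathrm{diag}(\lambda_1,\lambda_2,\lambda_3)$ and - (1.1) $B=\begin{pmatrix}\lambda_1&1&1\\0&\lambda_2&0\\0&0&\lambda_3\end{pmatrix}$, $\lambda_2=\lambda_1e^{\pm\pi i/3}$, $\lambda_3=\lambda_1e^{\mp\pi i/3}$; - (1.2) $B=\begin{pmatrix}\lambda_1&0&1\\0&\lambda_2&1\\0&0&\lambda_3\end{pmatrix}$, $\lambda_1=\lambda_3e^{\pm\pi i/3}$, $\lambda_2=\lambda_3e^{\mp\pi i/3}$; - (1.3) $B=\begin{pmatrix}\lambda_1&1&1\\0&\lambda_2&2\lambda_2\\0&0&\lambda_3\end{pmatrix}$,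 $\lambda_1=\lambda_2e^{\pm\pi i/3}$, $\lambda_3=\lambda_2e^{\mp\pi i/3}$; - (1.4) $B=\begin{pmatrix}\lambda_1&1&\frac{-\lambda_2^2(\lambda_1^2-\lambda_1\lambda_2+\lambda_2^2)}{\lambda_1(\lambda_1^2+\lambda_2^2)}\\0&\frac{-\lambda_1^4}{\lambda_2(\lambda_1^2+\lambda_2^2)}&\frac{\lambda_1^2(\lambda_1^4+\lambda_1^2\lambda_2^2+\lambda_2^4)}{(\lambda_1^2+\lambda_2^2)^2}\\0&1&\frac{\lambda_2^3}{\lambda_1^2+\lambda_2^2}\end{pmatrix}$, $\lambda_3=-\lambda_1^2/\lambda_2$. (2) $A=\mathrm{diag}(\lambda_1,\lambda_1,\lambda_2)$, $B=\begin{pmatrix}\lambda_1&1&\frac{\lambda_1\lambda_2}{\lambda_1-\lambda_2}\\0&\frac{\lambda_2^2}{\lambda_2-\lambda_1}&0\\0&1&\frac{\lambda_1^2}{\lambda_1-\lambda_2}\end{pmatrix}$, $\lambda_1=\lambda_2e^{\pm\pi i/3}$. (3) $A=\begin{pmatrix}\lambda_1&0&0\\0&\lambda_2&1\\0&0&\lambda_2\end{pmatrix}$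 and - (3.1) $B=\begin{pmatrix}\lambda_1&0&1\\0&\lambda_2&1\\0&0&\lambda_2\end{pmatrix}$, $\lambda_1=\lambda_2e^{\pm\pi i/3}$; - (3.2) $B=\begin{pmatrix}\lambda_1&1&\frac{\lambda_1+\lambda_2}{\lambda_1^2}\\0&\lambda_2&0\\0&\lambda_1^2&\lambda_2\end{pmatrix}$, $\lambda_2=\lambda_1e^{\pm\pi i/2}$. (4) $A=\begin{pmatrix}\lambda_1&1&0\\0&\lambda_1&0\\0&0&\lambda_2\end{pmatrix}$ and - (4.1) $B=\begin{pmatrix}\lambda_1&1+\frac{\lambda_1\beta}{\lambda_2^2}&1\\0&\lambda_1&0\\0&\beta&\lambda_2\end{pmatrix}$, $\lambda_1=\lambda_2e^{\pm\pi i/3}$, $\beta\in K$ arbitrary; - (4.2) $B=\begin{pmatrix}\lambda_1&-2&0\\0&\frac{\lambda_2}{2}&1\\0&\frac{3\lambda_2^2}{4}&-\frac{\lambda_2}{2}\end{pmatrix}$, $\lambda_1=-\lambda_2$. (5) $A=B=\begin{pmatrix}\lambda&1&0\\0&\lambda&1\\0&0&\lambda\end{pmatrix}$. Let $\mathrm{J}'$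 be the list obtained from $\mathrm{J}$ by requiring in addition $\lambda_1^4+\lambda_1^2\lambda_2^2+\lambda_2^4\neq0$ in (1.4) (that is, the $(2,3)$ entry of $B$ is nonzero). Then: (a) Every $3$-dimensional strictly indecomposable representation of $B_3$ over $K$ whose minimal nonzero invariant subspace has dimension $1$ is equivalent to the representation $\sigma_1\mapsto A$, $\sigma_2\mapsto B$ for some $(A,B)$ in $\mathrm{J}'$. (b) For every $(A,B)$ in $\mathrm{J}$, $\sigma_1\mapsto A$, $\sigma_2\mapsto B$ defines a representation of $B_3$ on $K^3$ that is strictly indecomposable (so reducible) and has a $1$-dimensional invariant subspace. (c) Two representations given by members of $\mathrm{J}'$ are equivalent if and only if they belong to the same item and have the same parameters, up to exchanging $\lambda_2$ and $\lambda_3$ in (1.1) and in (1.4), and exchanging $\lambda_1$ and $\lambda_2$ in (1.2). -/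

import Mathlib

/-- The Artin braid group on three strands,
`B₃ = ⟨σ₁, σ₂ ∣ σ₁ σ₂ σ₁ = σ₂ σ₁ σ₂⟩`; the generators are indexed by `Fin 2`. -/
abbrev BraidGroup3 : Type :=
  PresentedGroup
    ({FreeGroup.of 0 * FreeGroup.of 1 * FreeGroup.of 0 *
      (FreeGroup.of 1 * FreeGroup.of 0 * FreeGroup.of 1)⁻¹} : Set (FreeGroup (Fin 2)))

namespace BraidGroup3

/-- The first standard generator. -/
def σ₁ : BraidGroup3 := PresentedGroup.of 0

/-- The second standard generator. -/
def σ₂ : BraidGroup3 := PresentedGroup.of 1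

end BraidGroup3

section Representations

variable {K G V : Type*} [Field K] [Group G] [AddCommGroup V] [Module K V]

/-- A representation is indecomposable if it is not the direct sum of two nonzero
invariant subspaces. -/
def IsIndecomposableRep (ρ : Representation K G V) : Prop :=
  ∀ W₁ W₂ : Subrepresentation ρ, IsCompl W₁.toSubmodule W₂.toSubmodule →
    W₁.toSubmodule = ⊥ ∨ W₂.toSubmodule = ⊥

/-- Strictly indecomposable: indecomposable but not irreducible. -/
def IsStrictlyIndecomposable (ρ : Representation K G V) : Prop :=
  IsIndecomposableRep ρ ∧ ¬ ρ.IsIrreducible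

/-- The smallest dimension of a nonzero invariant subspace is `d`. -/
def MinInvariantDim (ρ : Representation K G V) (d : ℕ) : Prop :=
  IsLeast {k : ℕ | ∃ W : Subrepresentation ρ,
    W.toSubmodule ≠ ⊥ ∧ Module.finrank K W.toSubmodule = k} d

end Representations

/-- The parameters of the listed families of pairs of `3 × 3` matrices. -/
inductive B3Form (K : Type*) : Type _
  | f11 (l₁ l₂ l₃ : K)
  | f12 (l₁ l₂ l₃ : K)
  | f13 (l₁ l₂ l₃ : K)
  | f14 (l₁ l₂ l₃ : K)
  | f2 (l₁ l₂ : K)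
  | f31 (l₁ l₂ : K)
  | f32 (l₁ l₂ : K)
  | f41 (l₁ l₂ β : K)
  | f42 (l₁ l₂ : K)
  | f5 (l : K)

namespace B3Form

variable {K : Type*} [Field K]

/-- The matrix of `σ₁`, in Jordan form. -/
def matA : B3Form K → Matrix (Fin 3) (Fin 3) K
  | f11 l₁ l₂ l₃ | f12 l₁ l₂ l₃ | f13 l₁ l₂ l₃ | f14 l₁ l₂ l₃ =>
      !![l₁, 0, 0; 0, l₂, 0; 0, 0, l₃]
  | f2 l₁ l₂ => !![l₁, 0, 0; 0, l₁, 0; 0, 0, l₂]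
  | f31 l₁ l₂ | f32 l₁ l₂ => !![l₁, 0, 0; 0, l₂, 1; 0, 0, l₂]
  | f41 l₁ l₂ _ | f42 l₁ l₂ => !![l₁, 1, 0; 0, l₁, 0; 0, 0, l₂]
  | f5 l => !![l, 1, 0; 0, l, 1; 0, 0, l]

/-- The matrix of `σ₂`. -/
def matB : B3Form K → Matrix (Fin 3) (Fin 3) K
  | f11 l₁ l₂ l₃ => !![l₁, 1, 1; 0, l₂, 0; 0, 0, l₃]
  | f12 l₁ l₂ l₃ => !![l₁, 0, 1; 0, l₂, 1; 0, 0, l₃]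
  | f13 l₁ l₂ l₃ => !![l₁, 1, 1; 0, l₂, 2 * l₂; 0, 0, l₃]
  | f14 l₁ l₂ _ =>
      !![l₁, 1, -l₂ ^ 2 * (l₁ ^ 2 - l₁ * l₂ + l₂ ^ 2) / (l₁ * (l₁ ^ 2 + l₂ ^ 2));
         0, -l₁ ^ 4 / (l₂ * (l₁ ^ 2 + l₂ ^ 2)),
            l₁ ^ 2 * (l₁ ^ 4 + l₁ ^ 2 * l₂ ^ 2 + l₂ ^ 4) / (l₁ ^ 2 + l₂ ^ 2) ^ 2;
         0, 1, l₂ ^ 3 / (l₁ ^ 2 + l₂ ^ 2)]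
  | f2 l₁ l₂ =>
      !![l₁, 1, l₁ * l₂ / (l₁ - l₂);
         0, l₂ ^ 2 / (l₂ - l₁), 0;
         0, 1, l₁ ^ 2 / (l₁ - l₂)]
  | f31 l₁ l₂ => !![l₁, 0, 1; 0, l₂, 1; 0, 0, l₂]
  | f32 l₁ l₂ => !![l₁, 1, (l₁ + l₂) / l₁ ^ 2; 0, l₂, 0; 0, l₁ ^ 2, l₂]
  | f41 l₁ l₂ β => !![l₁, 1 + l₁ * β / l₂ ^ 2, 1; 0, l₁, 0; 0, β, l₂]
  | f42 l₁ l₂ => !![l₁, -2, 0; 0, l₂ / 2, 1; 0, 3 * l₂ ^ 2 / 4, -l₂ / 2]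
  | f5 l => !![l, 1, 0; 0, l, 1; 0, 0, l]

/-- The eigenvalues are nonzero and pairwise distinct and satisfy the relations of their family.
The values `e^{±πi/3}` and `e^{±πi/2}` are the primitive sixth and fourth roots of unity. -/
def Admissible : B3Form K → Prop
  | f11 l₁ l₂ l₃ => l₁ ≠ 0 ∧ l₂ ≠ 0 ∧ l₃ ≠ 0 ∧ l₁ ≠ l₂ ∧ l₁ ≠ l₃ ∧ l₂ ≠ l₃ ∧
      ∃ ζ : K, IsPrimitiveRoot ζ 6 ∧ l₂ = l₁ * ζ ∧ l₃ = l₁ * ζ⁻¹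
  | f12 l₁ l₂ l₃ => l₁ ≠ 0 ∧ l₂ ≠ 0 ∧ l₃ ≠ 0 ∧ l₁ ≠ l₂ ∧ l₁ ≠ l₃ ∧ l₂ ≠ l₃ ∧
      ∃ ζ : K, IsPrimitiveRoot ζ 6 ∧ l₁ = l₃ * ζ ∧ l₂ = l₃ * ζ⁻¹
  | f13 l₁ l₂ l₃ => l₁ ≠ 0 ∧ l₂ ≠ 0 ∧ l₃ ≠ 0 ∧ l₁ ≠ l₂ ∧ l₁ ≠ l₃ ∧ l₂ ≠ l₃ ∧
      ∃ ζ : K, IsPrimitiveRoot ζ 6 ∧ l₁ = l₂ * ζ ∧ l₃ = l₂ * ζ⁻¹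
  | f14 l₁ l₂ l₃ => l₁ ≠ 0 ∧ l₂ ≠ 0 ∧ l₃ ≠ 0 ∧ l₁ ≠ l₂ ∧ l₁ ≠ l₃ ∧ l₂ ≠ l₃ ∧
      l₃ = -l₁ ^ 2 / l₂
  | f2 l₁ l₂ => l₁ ≠ 0 ∧ l₂ ≠ 0 ∧ l₁ ≠ l₂ ∧ ∃ ζ : K, IsPrimitiveRoot ζ 6 ∧ l₁ = l₂ * ζ
  | f31 l₁ l₂ => l₁ ≠ 0 ∧ l₂ ≠ 0 ∧ l₁ ≠ l₂ ∧ ∃ ζ : K, IsPrimitiveRoot ζ 6 ∧ l₁ = l₂ * ζ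
  | f32 l₁ l₂ => l₁ ≠ 0 ∧ l₂ ≠ 0 ∧ l₁ ≠ l₂ ∧ ∃ ζ : K, IsPrimitiveRoot ζ 4 ∧ l₂ = l₁ * ζ
  | f41 l₁ l₂ _ => l₁ ≠ 0 ∧ l₂ ≠ 0 ∧ l₁ ≠ l₂ ∧ ∃ ζ : K, IsPrimitiveRoot ζ 6 ∧ l₁ = l₂ * ζ
  | f42 l₁ l₂ => l₁ ≠ 0 ∧ l₂ ≠ 0 ∧ l₁ ≠ l₂ ∧ l₁ = -l₂
  | f5 l => l ≠ 0

/-- In the fourth family the `(2,3)` entry of the second matrix must not vanish; when it does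
vanish the representation already occurs in the second or the third family. -/
def NoOverlap : B3Form K → Prop
  | f14 l₁ l₂ _ => l₁ ^ 4 + l₁ ^ 2 * l₂ ^ 2 + l₂ ^ 4 ≠ 0
  | _ => True

/-- `ρ` is the representation on `K³` with `σ₁ ↦ A` and `σ₂ ↦ B`, where `(A, B)` are the matrices
of `p`. -/
def IsRepOf (p : B3Form K) (ρ : Representation K BraidGroup3 (Fin 3 → K)) : Prop :=
  ρ BraidGroup3.σ₁ = Matrix.toLin' p.matA ∧ ρ BraidGroup3.σ₂ = Matrix.toLin' p.matB

/-- Same family and same parameters, up to the order of the two eigenvalues that play symmetric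
roles in the families `f11`, `f12` and `f14`. -/
inductive SameUpToOrder : B3Form K → B3Form K → Prop
  | refl (p : B3Form K) : SameUpToOrder p p
  | swap11 (l₁ l₂ l₃ : K) : SameUpToOrder (f11 l₁ l₂ l₃) (f11 l₁ l₃ l₂)
  | swap12 (l₁ l₂ l₃ : K) : SameUpToOrder (f12 l₁ l₂ l₃) (f12 l₂ l₁ l₃)
  | swap14 (l₁ l₂ l₃ : K) : SameUpToOrder (f14 l₁ l₂ l₃) (f14 l₁ l₃ l₂)

end B3Form

/-!
A representation of `B₃` is a pair of invertible matrices `A`, `B` with `ABA = BAB`. On an invariant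
line both generators act by the same scalar, because the braid relation turns into `a²b = ab²`. In
dimension `3` one of two complementary nonzero subspaces is a line, so the representation is
decomposable exactly when there are a common eigenvector `v` and a common left eigenvector `w` with
`w · v ≠ 0` (`Splits`, `HasMatrices.isIndecomposableRep_iff`). This makes the whole problem one
about pairs of matrices up to simultaneous conjugation.

Completeness. Take the common eigenvector as the first basis vector; conjugating the quotient block,
`A` becomes upper triangular and then reaches a normal form close to its Jordan form
(`classified_of_upper`), while `B` keeps its first column. The lower right `2 × 2` blocks satisfy
the braid relation on their own. When the block of `A` is diagonal with distinct entries, a Jordan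
block, or scalar, this has few solutions (`block_diag_cases`, `block_jordan_cases`,
`block_scalar_eq`). The two remaining equations of the braid relation constrain the first row of
`B`; they either exhibit a splitting or force the eigenvalue relations of one of the families, and a
diagonal change of basis normalizes the entries.

The listed pairs. The braid relation is checked entry by entry, and the common eigenvectors and
common left eigenvectors of each family are computed explicitly; none of them pair nontrivially
(`B3Form.not_splits`).

Inequivalence. The eigenvalues on the invariant lines, the same set for the transposed pair (the
eigenvalues on the one-dimensional quotients), and the trace of `A` are invariants, and together
with the eigenvalue relations they separate almost all members of the list
(`B3Form.sameUpToOrder_of_pairEquiv`). The family `f2` and the members of `f41` with `β ≠ 0` share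
these invariants, but `A` is diagonalizable in the former only (`B3Form.not_pairEquiv_f2_f41`); and
the parameter `β` is recovered from the matrices that commute with `A`
(`B3Form.beta_eq_of_pairEquiv`).
-/

open Matrix

/-! ### Primitive sixth and fourth roots of unity as quadratic relations -/

section RootsOfUnity

variable {K : Type*} [Field K] [CharZero K]

lemma isPrimitiveRoot_six_iff (z : K) : IsPrimitiveRoot z 6 ↔ z ^ 2 - z + 1 = 0 := by
  rw [← Polynomial.isRoot_cyclotomic_iff, Polynomial.cyclotomic_six]
  simp [Polynomial.IsRoot]

lemma isPrimitiveRoot_four_iff (z : K) : IsPrimitiveRoot z 4 ↔ z ^ 2 = -1 := by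
  have h : Polynomial.cyclotomic 4 K = Polynomial.X ^ 2 + 1 := by
    have := Polynomial.cyclotomic_prime_pow_eq_geom_sum (R := K) (p := 2) (n := 1) Nat.prime_two
    simp [Finset.sum_range_succ] at this
    rw [this, add_comm]
  rw [← Polynomial.isRoot_cyclotomic_iff, h]
  simp [Polynomial.IsRoot, eq_neg_iff_add_eq_zero]

lemma exists_six_iff {m a : K} (hm : m ≠ 0) :
    (∃ ζ : K, IsPrimitiveRoot ζ 6 ∧ a = m * ζ) ↔ a ^ 2 - a * m + m ^ 2 = 0 := by
  constructor
  · rintro ⟨ζ, h, rfl⟩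
    rw [isPrimitiveRoot_six_iff] at h
    linear_combination m ^ 2 * h
  · intro h
    refine ⟨a / m, (isPrimitiveRoot_six_iff _).2 ?_, by field_simp⟩
    field_simp
    linear_combination h

/-- A primitive sixth root of unity satisfies `ζ + ζ⁻¹ = 1`. -/
lemma exists_six_pair_iff {m a b : K} (hm : m ≠ 0) :
    (∃ ζ : K, IsPrimitiveRoot ζ 6 ∧ a = m * ζ ∧ b = m * ζ⁻¹) ↔
      a ^ 2 - a * m + m ^ 2 = 0 ∧ a + b = m := by
  have key : ∀ ζ : K, IsPrimitiveRoot ζ 6 → ζ⁻¹ = 1 - ζ := fun ζ h => by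
    rw [isPrimitiveRoot_six_iff] at h
    exact inv_eq_of_mul_eq_one_right (by linear_combination -h)
  constructor
  · rintro ⟨ζ, h, rfl, rfl⟩
    refine ⟨(exists_six_iff hm).1 ⟨ζ, h, rfl⟩, ?_⟩
    rw [key ζ h]; ring
  · rintro ⟨h, h'⟩
    obtain ⟨ζ, hζ, rfl⟩ := (exists_six_iff hm).2 h
    refine ⟨ζ, hζ, rfl, ?_⟩
    rw [key ζ hζ]
    linear_combination h'

lemma exists_four_iff {m a : K} (hm : m ≠ 0) :
    (∃ ζ : K, IsPrimitiveRoot ζ 4 ∧ a = m * ζ) ↔ a ^ 2 = -m ^ 2 := by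
  constructor
  · rintro ⟨ζ, h, rfl⟩
    rw [isPrimitiveRoot_four_iff] at h
    linear_combination m ^ 2 * h
  · intro h
    refine ⟨a / m, (isPrimitiveRoot_four_iff _).2 ?_, by field_simp⟩
    field_simp
    linear_combination h

end RootsOfUnity

/-! ### Pairs of matrices up to simultaneous conjugation -/

lemma matrix_three_eq_iff {α : Type*} {a₁ a₂ a₃ a₄ a₅ a₆ a₇ a₈ a₉ b₁ b₂ b₃ b₄ b₅ b₆ b₇ b₈ b₉ : α} :
    !![a₁, a₂, a₃; a₄, a₅, a₆; a₇, a₈, a₉] = !![b₁, b₂, b₃; b₄, b₅, b₆; b₇, b₈, b₉] ↔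
      (a₁ = b₁ ∧ a₂ = b₂ ∧ a₃ = b₃) ∧ (a₄ = b₄ ∧ a₅ = b₅ ∧ a₆ = b₆) ∧
      (a₇ = b₇ ∧ a₈ = b₈ ∧ a₉ = b₉) := by
  simp

section MatrixPairs

variable {K : Type*} [Field K]

/-- Simultaneous conjugacy of two pairs of matrices; the conjugating matrix `M` has the new basis
as columns. -/
def PairEquiv (A B A' B' : Matrix (Fin 3) (Fin 3) K) : Prop :=
  ∃ M : Matrix (Fin 3) (Fin 3) K, M.det ≠ 0 ∧ A * M = M * A' ∧ B * M = M * B'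

/-- `v` spans a line on which both matrices act by the same scalar `c`. -/
def IsEigenline (A B : Matrix (Fin 3) (Fin 3) K) (c : K) (v : Fin 3 → K) : Prop :=
  v ≠ 0 ∧ A *ᵥ v = c • v ∧ B *ᵥ v = c • v

/-- The pair splits off a line: `v` spans an invariant line and the kernel of the functional `w` is
an invariant plane that does not contain `v`. -/
def Splits (A B : Matrix (Fin 3) (Fin 3) K) : Prop :=
  ∃ (c : K) (v w : Fin 3 → K), IsEigenline A B c v ∧ IsEigenline Aᵀ Bᵀ c w ∧ w ⬝ᵥ v ≠ 0

variable {A B A' B' A'' B'' : Matrix (Fin 3) (Fin 3) K}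

lemma PairEquiv.refl (A B : Matrix (Fin 3) (Fin 3) K) : PairEquiv A B A B :=
  ⟨1, by simp, by simp, by simp⟩

lemma PairEquiv.symm (h : PairEquiv A B A' B') : PairEquiv A' B' A B := by
  obtain ⟨M, hM, hA, hB⟩ := h
  have hu : IsUnit M.det := hM.isUnit
  refine ⟨M⁻¹, by simpa [Matrix.det_nonsing_inv] using hM, ?_, ?_⟩
  · calc A' * M⁻¹ = M⁻¹ * (M * A') * M⁻¹ := by rw [nonsing_inv_mul_cancel_left _ _ hu]
      _ = M⁻¹ * A := by rw [← hA, ← mul_assoc, mul_nonsing_inv_cancel_right _ _ hu]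
  · calc B' * M⁻¹ = M⁻¹ * (M * B') * M⁻¹ := by rw [nonsing_inv_mul_cancel_left _ _ hu]
      _ = M⁻¹ * B := by rw [← hB, ← mul_assoc, mul_nonsing_inv_cancel_right _ _ hu]

lemma PairEquiv.trans (h : PairEquiv A B A' B') (h' : PairEquiv A' B' A'' B'') :
    PairEquiv A B A'' B'' := by
  obtain ⟨M, hM, hA, hB⟩ := h
  obtain ⟨N, hN, hA', hB'⟩ := h'
  exact ⟨M * N, by simp [hM, hN], by rw [← mul_assoc, hA, mul_assoc, hA', mul_assoc],
    by rw [← mul_assoc, hB, mul_assoc, hB', mul_assoc]⟩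

lemma PairEquiv.transpose (h : PairEquiv A B A' B') : PairEquiv A'ᵀ B'ᵀ Aᵀ Bᵀ := by
  obtain ⟨M, hM, hA, hB⟩ := h
  exact ⟨Mᵀ, by simpa using hM, by rw [← transpose_mul, ← transpose_mul, hA],
    by rw [← transpose_mul, ← transpose_mul, hB]⟩

lemma PairEquiv.braid (h : PairEquiv A B A' B') (hb : A * B * A = B * A * B) :
    A' * B' * A' = B' * A' * B' := by
  obtain ⟨M, hM, hA, hB⟩ := h
  have key : ∀ {X Y X' Y' : Matrix (Fin 3) (Fin 3) K}, X * M = M * X' → Y * M = M * Y' →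
      X * Y * M = M * (X' * Y') := fun hX hY => by
    rw [mul_assoc, hY, ← mul_assoc, hX, mul_assoc]
  apply ((isUnit_iff_isUnit_det M).2 hM.isUnit).mul_left_cancel
  rw [← key (key hA hB) hA, ← key (key hB hA) hB, hb]

lemma PairEquiv.det_left (h : PairEquiv A B A' B') : A'.det = A.det := by
  obtain ⟨M, hM, hA, hB⟩ := h
  have := congrArg det hA
  rw [det_mul, det_mul, mul_comm] at this
  exact (mul_left_cancel₀ hM this).symm

lemma PairEquiv.det_right (h : PairEquiv A B A' B') : B'.det = B.det := by
  obtain ⟨M, hM, hA, hB⟩ := h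
  have := congrArg det hB
  rw [det_mul, det_mul, mul_comm] at this
  exact (mul_left_cancel₀ hM this).symm

lemma PairEquiv.trace_left (h : PairEquiv A B A' B') : A'.trace = A.trace := by
  obtain ⟨M, hM, hA, hB⟩ := h
  have hu : IsUnit M.det := hM.isUnit
  have : A' = M⁻¹ * (A * M) := by rw [hA, nonsing_inv_mul_cancel_left _ _ hu]
  rw [this, trace_mul_comm, mul_nonsing_inv_cancel_right _ _ hu]

lemma IsEigenline.of_pairEquiv {c : K} {v : Fin 3 → K} {M : Matrix (Fin 3) (Fin 3) K}
    (hv : IsEigenline A' B' c v) (hM : M.det ≠ 0) (hA : A * M = M * A') (hB : B * M = M * B') :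
    IsEigenline A B c (M *ᵥ v) := by
  refine ⟨fun h => hv.1 ?_, ?_, ?_⟩
  · have hu : IsUnit M.det := hM.isUnit
    have := congrArg (M⁻¹ *ᵥ ·) h
    simpa [mulVec_mulVec, nonsing_inv_mul _ hu] using this
  · rw [mulVec_mulVec, hA, ← mulVec_mulVec, hv.2.1, mulVec_smul]
  · rw [mulVec_mulVec, hB, ← mulVec_mulVec, hv.2.2, mulVec_smul]

lemma PairEquiv.exists_eigenline_iff (h : PairEquiv A B A' B') (c : K) :
    (∃ v, IsEigenline A B c v) ↔ ∃ v, IsEigenline A' B' c v := by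
  constructor
  · rintro ⟨v, hv⟩
    obtain ⟨M, hM, hA, hB⟩ := h.symm
    exact ⟨_, hv.of_pairEquiv hM hA hB⟩
  · rintro ⟨v, hv⟩
    obtain ⟨M, hM, hA, hB⟩ := h
    exact ⟨_, hv.of_pairEquiv hM hA hB⟩

lemma PairEquiv.splits (h : PairEquiv A B A' B') (hs : Splits A' B') : Splits A B := by
  obtain ⟨c, v, w, hv, hw, hvw⟩ := hs
  obtain ⟨M, hM, hA, hB⟩ := h
  have hu : IsUnit M.det := hM.isUnit
  refine ⟨c, M *ᵥ v, (M⁻¹)ᵀ *ᵥ w, hv.of_pairEquiv hM hA hB, ?_, ?_⟩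
  · refine hw.of_pairEquiv (by simpa [det_nonsing_inv] using hM) ?_ ?_
    · rw [← transpose_mul, ← transpose_mul]
      congr 1
      calc M⁻¹ * A = M⁻¹ * (A * M) * M⁻¹ := by rw [← mul_assoc, mul_nonsing_inv_cancel_right _ _ hu]
        _ = _ := by rw [hA, nonsing_inv_mul_cancel_left _ _ hu]
    · rw [← transpose_mul, ← transpose_mul]
      congr 1
      calc M⁻¹ * B = M⁻¹ * (B * M) * M⁻¹ := by rw [← mul_assoc, mul_nonsing_inv_cancel_right _ _ hu]
        _ = _ := by rw [hB, nonsing_inv_mul_cancel_left _ _ hu]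
  · rw [mulVec_transpose, ← dotProduct_mulVec, mulVec_mulVec, nonsing_inv_mul _ hu, one_mulVec]
    exact hvw

lemma isEigenline_iff {a₁ a₂ a₃ a₄ a₅ a₆ a₇ a₈ a₉ b₁ b₂ b₃ b₄ b₅ b₆ b₇ b₈ b₉ c : K}
    {v : Fin 3 → K} :
    IsEigenline !![a₁, a₂, a₃; a₄, a₅, a₆; a₇, a₈, a₉] !![b₁, b₂, b₃; b₄, b₅, b₆; b₇, b₈, b₉] c v ↔
      ¬(v 0 = 0 ∧ v 1 = 0 ∧ v 2 = 0) ∧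
      (a₁ * v 0 + a₂ * v 1 + a₃ * v 2 = c * v 0 ∧ a₄ * v 0 + a₅ * v 1 + a₆ * v 2 = c * v 1 ∧
        a₇ * v 0 + a₈ * v 1 + a₉ * v 2 = c * v 2) ∧
      (b₁ * v 0 + b₂ * v 1 + b₃ * v 2 = c * v 0 ∧ b₄ * v 0 + b₅ * v 1 + b₆ * v 2 = c * v 1 ∧
        b₇ * v 0 + b₈ * v 1 + b₉ * v 2 = c * v 2) := by
  simp [IsEigenline, funext_iff, Fin.forall_fin_succ, dotProduct, Fin.sum_univ_three]

lemma isEigenline_transpose_iff {a₁ a₂ a₃ a₄ a₅ a₆ a₇ a₈ a₉ b₁ b₂ b₃ b₄ b₅ b₆ b₇ b₈ b₉ c : K}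
    {v : Fin 3 → K} :
    IsEigenline !![a₁, a₂, a₃; a₄, a₅, a₆; a₇, a₈, a₉]ᵀ
        !![b₁, b₂, b₃; b₄, b₅, b₆; b₇, b₈, b₉]ᵀ c v ↔
      ¬(v 0 = 0 ∧ v 1 = 0 ∧ v 2 = 0) ∧
      (a₁ * v 0 + a₄ * v 1 + a₇ * v 2 = c * v 0 ∧ a₂ * v 0 + a₅ * v 1 + a₈ * v 2 = c * v 1 ∧
        a₃ * v 0 + a₆ * v 1 + a₉ * v 2 = c * v 2) ∧
      (b₁ * v 0 + b₄ * v 1 + b₇ * v 2 = c * v 0 ∧ b₂ * v 0 + b₅ * v 1 + b₈ * v 2 = c * v 1 ∧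
        b₃ * v 0 + b₆ * v 1 + b₉ * v 2 = c * v 2) := by
  simp [IsEigenline, funext_iff, Fin.forall_fin_succ, mulVec, dotProduct, Fin.sum_univ_three,
    Matrix.transpose_apply]

lemma splits_of_entries {a₁ a₂ a₃ a₄ a₅ a₆ a₇ a₈ a₉ b₁ b₂ b₃ b₄ b₅ b₆ b₇ b₈ b₉ : K}
    (c v₁ v₂ v₃ w₁ w₂ w₃ : K)
    (hA : a₁ * v₁ + a₂ * v₂ + a₃ * v₃ = c * v₁ ∧ a₄ * v₁ + a₅ * v₂ + a₆ * v₃ = c * v₂ ∧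
      a₇ * v₁ + a₈ * v₂ + a₉ * v₃ = c * v₃)
    (hB : b₁ * v₁ + b₂ * v₂ + b₃ * v₃ = c * v₁ ∧ b₄ * v₁ + b₅ * v₂ + b₆ * v₃ = c * v₂ ∧
      b₇ * v₁ + b₈ * v₂ + b₉ * v₃ = c * v₃)
    (hA' : a₁ * w₁ + a₄ * w₂ + a₇ * w₃ = c * w₁ ∧ a₂ * w₁ + a₅ * w₂ + a₈ * w₃ = c * w₂ ∧
      a₃ * w₁ + a₆ * w₂ + a₉ * w₃ = c * w₃)
    (hB' : b₁ * w₁ + b₄ * w₂ + b₇ * w₃ = c * w₁ ∧ b₂ * w₁ + b₅ * w₂ + b₈ * w₃ = c * w₂ ∧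
      b₃ * w₁ + b₆ * w₂ + b₉ * w₃ = c * w₃)
    (h : w₁ * v₁ + w₂ * v₂ + w₃ * v₃ ≠ 0) :
    Splits !![a₁, a₂, a₃; a₄, a₅, a₆; a₇, a₈, a₉] !![b₁, b₂, b₃; b₄, b₅, b₆; b₇, b₈, b₉] := by
  refine ⟨c, ![v₁, v₂, v₃], ![w₁, w₂, w₃],
    isEigenline_iff.2 ⟨?_, by simpa using hA, by simpa using hB⟩,
    isEigenline_transpose_iff.2 ⟨?_, by simpa using hA', by simpa using hB'⟩, ?_⟩
  · rintro ⟨h1, h2, h3⟩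
    simp_all
  · rintro ⟨h1, h2, h3⟩
    simp_all
  · simpa [dotProduct, Fin.sum_univ_three] using h

lemma pairEquiv_of_entries
    {a₁ a₂ a₃ a₄ a₅ a₆ a₇ a₈ a₉ b₁ b₂ b₃ b₄ b₅ b₆ b₇ b₈ b₉ : K}
    {c₁ c₂ c₃ c₄ c₅ c₆ c₇ c₈ c₉ d₁ d₂ d₃ d₄ d₅ d₆ d₇ d₈ d₉ : K}
    (m₁ m₂ m₃ m₄ m₅ m₆ m₇ m₈ m₉ : K)
    (hM : m₁ * m₅ * m₉ - m₁ * m₆ * m₈ - m₂ * m₄ * m₉ + m₂ * m₆ * m₇ + m₃ * m₄ * m₈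
      - m₃ * m₅ * m₇ ≠ 0)
    (hA : !![a₁, a₂, a₃; a₄, a₅, a₆; a₇, a₈, a₉] * !![m₁, m₂, m₃; m₄, m₅, m₆; m₇, m₈, m₉] =
      !![m₁, m₂, m₃; m₄, m₅, m₆; m₇, m₈, m₉] * !![c₁, c₂, c₃; c₄, c₅, c₆; c₇, c₈, c₉])
    (hB : !![b₁, b₂, b₃; b₄, b₅, b₆; b₇, b₈, b₉] * !![m₁, m₂, m₃; m₄, m₅, m₆; m₇, m₈, m₉] =
      !![m₁, m₂, m₃; m₄, m₅, m₆; m₇, m₈, m₉] * !![d₁, d₂, d₃; d₄, d₅, d₆; d₇, d₈, d₉]) :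
    PairEquiv !![a₁, a₂, a₃; a₄, a₅, a₆; a₇, a₈, a₉] !![b₁, b₂, b₃; b₄, b₅, b₆; b₇, b₈, b₉]
      !![c₁, c₂, c₃; c₄, c₅, c₆; c₇, c₈, c₉] !![d₁, d₂, d₃; d₄, d₅, d₆; d₇, d₈, d₉] :=
  ⟨_, by simpa [det_fin_three] using hM, hA, hB⟩

/-- The braid relation for a common eigenvector `e₁` and upper triangular `A`. The first four
equations are the relation for the lower right blocks, the last two come from the first row. -/
lemma braid_entries {l u v a c b x y p q r s : K}
    (h : !![l, u, v; 0, a, c; 0, 0, b] * !![l, x, y; 0, p, q; 0, r, s] *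
        !![l, u, v; 0, a, c; 0, 0, b] =
      !![l, x, y; 0, p, q; 0, r, s] * !![l, u, v; 0, a, c; 0, 0, b] *
        !![l, x, y; 0, p, q; 0, r, s]) :
    ((a * p + c * r) * a = p * (a * p + c * r) + q * b * r ∧
    (a * p + c * r) * c + (a * q + c * s) * b = p * (a * q + c * s) + q * b * s ∧
    a * b * r = r * (a * p + c * r) + s * b * r ∧
    b * r * c + b ^ 2 * s = r * (a * q + c * s) + b * s ^ 2) ∧
    l ^ 2 * u + (l * x + u * p + v * r) * a =
      l * (l * x + u * p + v * r) + x * (a * p + c * r) + y * b * r ∧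
    l ^ 2 * v + (l * x + u * p + v * r) * c + (l * y + u * q + v * s) * b =
      l * (l * y + u * q + v * s) + x * (a * q + c * s) + y * b * s := by
  simp only [mul_fin_three, matrix_three_eq_iff] at h
  obtain ⟨⟨-, h2, h3⟩, ⟨-, h5, h6⟩, -, h8, h9⟩ := h
  refine ⟨⟨?_, ?_, ?_, ?_⟩, ?_, ?_⟩
  · linear_combination h5
  · linear_combination h6
  · linear_combination h8
  · linear_combination h9
  · linear_combination h2
  · linear_combination h3

end MatrixPairs

/-! ### Indecomposable braid pairs -/

section Classification

variable {K : Type*} [Field K]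

/-- The matrices of the two generators in a three-dimensional representation of the braid group that
has no invariant line with an invariant complement. -/
structure IsIndecBraidPair (A B : Matrix (Fin 3) (Fin 3) K) : Prop where
  braid : A * B * A = B * A * B
  det_left : A.det ≠ 0
  det_right : B.det ≠ 0
  not_splits : ¬ Splits A B

/-- The pair is conjugate to a member of the list without overlaps. -/
def Classified (A B : Matrix (Fin 3) (Fin 3) K) : Prop :=
  ∃ p : B3Form K, p.Admissible ∧ p.NoOverlap ∧ PairEquiv A B p.matA p.matB

variable {A B A' B' : Matrix (Fin 3) (Fin 3) K}

lemma IsIndecBraidPair.of_pairEquiv (G : IsIndecBraidPair A B) (h : PairEquiv A B A' B') :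
    IsIndecBraidPair A' B' where
  braid := h.braid G.braid
  det_left := h.det_left ▸ G.det_left
  det_right := h.det_right ▸ G.det_right
  not_splits hs := G.not_splits (h.splits hs)

lemma Classified.of_pairEquiv (C : Classified A' B') (h : PairEquiv A B A' B') :
    Classified A B := by
  obtain ⟨p, hp, hp', hpe⟩ := C
  exact ⟨p, hp, hp', h.trans hpe⟩

/-- Conjugation by a diagonal matrix, entry by entry. -/
lemma pairEquiv_diagonal {a₁ a₂ a₃ a₄ a₅ a₆ a₇ a₈ a₉ b₁ b₂ b₃ b₄ b₅ b₆ b₇ b₈ b₉ : K}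
    {c₁ c₂ c₃ c₄ c₅ c₆ c₇ c₈ c₉ d₁ d₂ d₃ d₄ d₅ d₆ d₇ d₈ d₉ : K} (m₁ m₂ m₃ : K)
    (h₁ : m₁ ≠ 0) (h₂ : m₂ ≠ 0) (h₃ : m₃ ≠ 0)
    (hA : (a₁ * m₁ = m₁ * c₁ ∧ a₂ * m₂ = m₁ * c₂ ∧ a₃ * m₃ = m₁ * c₃) ∧
      (a₄ * m₁ = m₂ * c₄ ∧ a₅ * m₂ = m₂ * c₅ ∧ a₆ * m₃ = m₂ * c₆) ∧
      (a₇ * m₁ = m₃ * c₇ ∧ a₈ * m₂ = m₃ * c₈ ∧ a₉ * m₃ = m₃ * c₉))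
    (hB : (b₁ * m₁ = m₁ * d₁ ∧ b₂ * m₂ = m₁ * d₂ ∧ b₃ * m₃ = m₁ * d₃) ∧
      (b₄ * m₁ = m₂ * d₄ ∧ b₅ * m₂ = m₂ * d₅ ∧ b₆ * m₃ = m₂ * d₆) ∧
      (b₇ * m₁ = m₃ * d₇ ∧ b₈ * m₂ = m₃ * d₈ ∧ b₉ * m₃ = m₃ * d₉)) :
    PairEquiv !![a₁, a₂, a₃; a₄, a₅, a₆; a₇, a₈, a₉] !![b₁, b₂, b₃; b₄, b₅, b₆; b₇, b₈, b₉]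
      !![c₁, c₂, c₃; c₄, c₅, c₆; c₇, c₈, c₉] !![d₁, d₂, d₃; d₄, d₅, d₆; d₇, d₈, d₉] := by
  refine pairEquiv_of_entries m₁ 0 0 0 m₂ 0 0 0 m₃ (by simp [h₁, h₂, h₃]) ?_ ?_
  · simpa [mul_fin_three] using hA
  · simpa [mul_fin_three] using hB

/-- Conjugation by the transposition of the last two basis vectors. -/
lemma pairEquiv_swap {a₁ a₂ a₃ a₄ a₅ a₆ a₇ a₈ a₉ b₁ b₂ b₃ b₄ b₅ b₆ b₇ b₈ b₉ : K} :
    PairEquiv !![a₁, a₂, a₃; a₄, a₅, a₆; a₇, a₈, a₉] !![b₁, b₂, b₃; b₄, b₅, b₆; b₇, b₈, b₉]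
      !![a₁, a₃, a₂; a₇, a₉, a₈; a₄, a₆, a₅] !![b₁, b₃, b₂; b₇, b₉, b₈; b₄, b₆, b₅] :=
  pairEquiv_of_entries 1 0 0 0 0 1 0 1 0 (by simp) (by simp) (by simp)

/-- A change of basis that fixes `e₁` and brings `A` into the form `A'` keeps the first column of
`B`. -/
lemma exists_pairEquiv_of_mul_eq {l x y p q r s m₂ m₃ m₅ m₆ m₈ m₉ : K}
    (hM : m₅ * m₉ - m₆ * m₈ ≠ 0)
    (hA : A * !![1, m₂, m₃; 0, m₅, m₆; 0, m₈, m₉] = !![1, m₂, m₃; 0, m₅, m₆; 0, m₈, m₉] * A') :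
    ∃ x' y' p' q' r' s' : K, PairEquiv A !![l, x, y; 0, p, q; 0, r, s]
      A' !![l, x', y'; 0, p', q'; 0, r', s'] := by
  set M : Matrix (Fin 3) (Fin 3) K := !![1, m₂, m₃; 0, m₅, m₆; 0, m₈, m₉] with hMdef
  set B : Matrix (Fin 3) (Fin 3) K := !![l, x, y; 0, p, q; 0, r, s] with hBdef
  have hdet : M.det ≠ 0 := by simpa [hMdef, det_fin_three] using hM
  have hB : B * M = M * (M⁻¹ * B * M) := by
    rw [← mul_assoc, ← mul_assoc, mul_nonsing_inv _ hdet.isUnit, one_mul]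
  set N := M⁻¹ * B * M with hN
  have hcol : N *ᵥ ![1, 0, 0] = ![l, 0, 0] := by
    have h1 : M *ᵥ ![1, 0, 0] = ![1, 0, 0] := by
      simp [hMdef, funext_iff, Fin.forall_fin_succ]
    have h2 : B *ᵥ ![1, 0, 0] = l • ![1, 0, 0] := by
      simp [hBdef, funext_iff, Fin.forall_fin_succ]
    have h3 : M⁻¹ *ᵥ ![1, 0, 0] = ![1, 0, 0] := by
      conv_lhs => rw [← h1, mulVec_mulVec, nonsing_inv_mul _ hdet.isUnit, one_mulVec]
    rw [hN, ← mulVec_mulVec, h1, ← mulVec_mulVec, h2, mulVec_smul, h3]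
    simp
  have e0 : N 0 0 = l ∧ N 1 0 = 0 ∧ N 2 0 = 0 := by
    simpa [funext_iff, Fin.forall_fin_succ, mulVec, dotProduct, Fin.sum_univ_three] using hcol
  refine ⟨N 0 1, N 0 2, N 1 1, N 1 2, N 2 1, N 2 2, M, hdet, hA, ?_⟩
  rw [hB]
  congr 1
  rw [eta_fin_three N, e0.1, e0.2.1, e0.2.2]
  simp

end Classification

/-! ### The braid relation for `2 × 2` blocks -/

section Classification

variable {K : Type*} [Field K]

/-- Solutions of the braid relation for `2 × 2` matrices `diag(a, b)` and `(p, q; r, s)` with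
`a ≠ b`: either triangular with the same diagonal, or irreducible. -/
lemma block_diag_cases {a b p q r s : K} (ha : a ≠ 0) (hb : b ≠ 0) (hab : a ≠ b)
    (hdet : p * s - q * r ≠ 0)
    (e22 : a ^ 2 * p = a * p ^ 2 + b * (q * r)) (e23 : a * b * q = q * (a * p + b * s))
    (e32 : a * b * r = r * (a * p + b * s)) (e33 : b ^ 2 * s = a * (q * r) + b * s ^ 2) :
    (p = a ∧ s = b ∧ q * r = 0 ∧ (q ≠ 0 ∨ r ≠ 0 → a ^ 2 - a * b + b ^ 2 = 0)) ∨
    (q ≠ 0 ∧ r ≠ 0 ∧ p * (b - a) = b ^ 2 ∧ s * (a - b) = a ^ 2 ∧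
      q * r * (a - b) ^ 2 = - (a * b * (a ^ 2 - a * b + b ^ 2))) := by
  by_cases hqr : q * r = 0
  · left
    rw [hqr] at e22 e33 hdet
    have hp : p ≠ 0 := by rintro rfl; simp at hdet
    have hs : s ≠ 0 := by rintro rfl; simp at hdet
    have h1 : p = a := mul_left_cancel₀ (mul_ne_zero ha hp) (by linear_combination -e22)
    have h2 : s = b := mul_left_cancel₀ (mul_ne_zero hb hs) (by linear_combination -e33)
    subst h1 h2
    refine ⟨rfl, rfl, hqr, ?_⟩
    rintro (h | h)
    · exact mul_left_cancel₀ h (by linear_combination -e23)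
    · exact mul_left_cancel₀ h (by linear_combination -e32)
  · right
    have hq : q ≠ 0 := left_ne_zero_of_mul hqr
    have hr : r ≠ 0 := right_ne_zero_of_mul hqr
    have h1 : a * p + b * s = a * b := mul_left_cancel₀ hr (by linear_combination -e32)
    have hp : p * (b - a) = b ^ 2 := by
      have : a * (b - a) * (p * (b - a) - b ^ 2) = 0 := by
        clear * - h1 e22 e33 hb
        grind
      simpa [ha, sub_ne_zero.2 hab.symm, sub_eq_zero] using this
    refine ⟨hq, hr, hp, mul_left_cancel₀ hb (by linear_combination a * hp + (a-b) * h1),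
      mul_left_cancel₀ hb ?_⟩
    linear_combination -(a - b) ^ 2 * e22 + a * ((b - a) * a - p * (b - a) - b ^ 2) * hp

/-- An invertible `2 × 2` matrix in braid relation with the scalar matrix `a` is equal to it. -/
lemma block_scalar_eq {a p q r s : K} (ha : a ≠ 0) (hdet : p * s - q * r ≠ 0)
    (e22 : a ^ 2 * p = a * p ^ 2 + a * (q * r)) (e23 : a * a * q = q * (a * p + a * s))
    (e32 : a * a * r = r * (a * p + a * s)) (e33 : a ^ 2 * s = a * (q * r) + a * s ^ 2) :
    p = a ∧ q = 0 ∧ r = 0 ∧ s = a := by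
  -- trace `a` would make the determinant vanish
  have hT : p + s ≠ a := by
    intro h
    apply hdet
    apply mul_left_cancel₀ ha
    linear_combination e22 + a * p * h
  have hT' : a * (a - (p + s)) ≠ 0 := mul_ne_zero ha (sub_ne_zero.2 hT.symm)
  have hq : q = 0 := mul_left_cancel₀ hT' (by linear_combination e23)
  have hr : r = 0 := mul_left_cancel₀ hT' (by linear_combination e32)
  subst hq hr
  have hp : p ≠ 0 := by rintro rfl; simp at hdet
  have hs : s ≠ 0 := by rintro rfl; simp at hdet
  exact ⟨mul_left_cancel₀ (mul_ne_zero ha hp) (by linear_combination -e22), rfl, rfl,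
    mul_left_cancel₀ (mul_ne_zero ha hs) (by linear_combination -e33)⟩

/-- Solutions of the braid relation for `(a, 1; 0, a)` and `(p, q; r, s)`: either the two are equal,
or `r ≠ 0` and the second block has trace `2 a` and determinant `a ^ 2`. -/
lemma block_jordan_cases {a p q r s : K} (ha : a ≠ 0) (hdet : p * s - q * r ≠ 0)
    (e22 : (a * p + r) * a = p * (a * p + r) + q * a * r)
    (e23 : (a * p + r) + (a * q + s) * a = p * (a * q + s) + q * a * s)
    (e32 : a * a * r = r * (a * p + r) + s * a * r)
    (e33 : a * r + a ^ 2 * s = r * (a * q + s) + a * s ^ 2) :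
    (p = a ∧ q = 1 ∧ r = 0 ∧ s = a) ∨
      (r = -a ^ 2 ∧ s = 2 * a - p ∧ a ^ 2 * q = (p - a) ^ 2) := by
  by_cases hr : r = 0
  · left
    subst hr
    have hp : p ≠ 0 := by rintro rfl; simp at hdet
    have hs : s ≠ 0 := by rintro rfl; simp at hdet
    have h1 : p = a := mul_left_cancel₀ (mul_ne_zero ha hp) (by linear_combination -e22)
    have h2 : s = a := mul_left_cancel₀ (mul_ne_zero ha hs) (by linear_combination -e33)
    subst h1 h2
    exact ⟨rfl, mul_left_cancel₀ (pow_ne_zero 2 ha) (by linear_combination -e23), rfl, rfl⟩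
  · right
    have h1 : r = a ^ 2 - a * p - a * s := mul_left_cancel₀ hr (by linear_combination -e32)
    have h2 : a * (p + s) - a ^ 2 = p * s - q * r := by
      apply mul_left_cancel₀ ha
      linear_combination (-p + a) * h1 - e22
    have h3 : p * s - q * r = a ^ 2 := by
      linear_combination -e23 + (1 - q) * h1
    have h4 : s = 2 * a - p := mul_left_cancel₀ ha (by linear_combination h2 + h3)
    have h5 : r = -a ^ 2 := by linear_combination h1 - a * h4
    exact ⟨h5, h4, by rw [h5, h4] at h3; linear_combination h3⟩

/-! ### First eigenvalue different from the others -/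

lemma diag_entries_ne_zero {l u v a c b : K} {B : Matrix (Fin 3) (Fin 3) K}
    (G : IsIndecBraidPair !![l, u, v; 0, a, c; 0, 0, b] B) : l ≠ 0 ∧ a ≠ 0 ∧ b ≠ 0 := by
  have := G.det_left
  rw [det_fin_three] at this
  simpa [and_assoc] using this

lemma block_det_ne_zero {l x y p q r s : K} {A : Matrix (Fin 3) (Fin 3) K}
    (G : IsIndecBraidPair A !![l, x, y; 0, p, q; 0, r, s]) : p * s - q * r ≠ 0 := by
  have := G.det_right
  rw [det_fin_three] at this
  intro h
  apply this
  simp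
  linear_combination l * h

/-- If the first row is zero off the diagonal, the first coordinate line splits off. -/
lemma false_of_row_eq_zero {l a c b x y p q r s : K}
    (G : IsIndecBraidPair !![l, 0, 0; 0, a, c; 0, 0, b] !![l, x, y; 0, p, q; 0, r, s])
    (hx : x = 0) (hy : y = 0) : False := by
  subst hx hy
  exact G.not_splits (splits_of_entries l 1 0 0 1 0 0 (by simp) (by simp) (by simp) (by simp)
      (by simp))

/-- If `A` acts as a scalar on the quotient, so does `B`, and the vector `(0, y, -x)`, which the
first row of `B` kills, spans a line that splits off. -/
lemma not_isIndecBraidPair_scalar {l a x y p q r s : K}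
    (G : IsIndecBraidPair !![l, 0, 0; 0, a, 0; 0, 0, a] !![l, x, y; 0, p, q; 0, r, s]) :
    False := by
  obtain ⟨⟨e22, e23, e32, e33⟩, e12, e13⟩ := braid_entries G.braid
  obtain ⟨hl, ha, -⟩ := diag_entries_ne_zero G
  obtain ⟨hp, hq, hr, hs⟩ := block_scalar_eq ha (block_det_ne_zero G)
    (by linear_combination e22) (by linear_combination e23) (by linear_combination e32)
    (by linear_combination e33)
  rw [hp, hq, hr, hs] at G
  by_cases hy : y = 0
  · subst hy
    by_cases hx : x = 0
    · exact false_of_row_eq_zero G hx rfl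
    · exact G.not_splits (splits_of_entries a 0 0 (-x) 0 0 1 (by simp) (by simp) (by simp) (by simp)
        (by simpa using hx))
  · exact G.not_splits (splits_of_entries a 0 y (-x) 0 1 0 (by simp) (by simp; ring) (by simp)
      (by simp) (by simpa using hy))

variable [CharZero K]

/-- The quotient by the invariant line is irreducible, which leads to the family `f14`. -/
lemma classified_diag_of_irreducible {l a b x y p q r s : K}
    (G : IsIndecBraidPair !![l, 0, 0; 0, a, 0; 0, 0, b] !![l, x, y; 0, p, q; 0, r, s])
    (hla : l ≠ a) (hlb : l ≠ b) (hab : a ≠ b) (hq : q ≠ 0) (hr : r ≠ 0) :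
    Classified !![l, 0, 0; 0, a, 0; 0, 0, b] !![l, x, y; 0, p, q; 0, r, s] := by
  obtain ⟨⟨e22, e23, e32, e33⟩, e12, e13⟩ := braid_entries G.braid
  obtain ⟨hl, ha, hb⟩ := diag_entries_ne_zero G
  obtain ⟨-, -, h, -⟩ | ⟨-, -, hp, hs, hqr⟩ := block_diag_cases ha hb hab (block_det_ne_zero G)
    (by linear_combination e22) (by linear_combination e23) (by linear_combination e32)
    (by linear_combination e33)
  · exact absurd h (mul_ne_zero hq hr)
  have hx : x ≠ 0 := by
    rintro rfl
    have hy : y = 0 := by simpa [hb, hr] using e12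
    exact false_of_row_eq_zero G rfl hy
  have hy : y ≠ 0 := by
    rintro rfl
    simp [hx, ha, hq] at e13
  -- the two first-row equations are a homogeneous linear system with the nonzero solution `(x, y)`,
  -- so its determinant vanishes
  have hl2 : l ^ 2 = - (a * b) := by
    have e : x * y * ((l * a - l ^ 2 - a * p) * (l * b - l ^ 2 - b * s) - a * b * q * r) = 0 := by
      linear_combination y * (l * b - l ^ 2 - b * s) * e12 + y * b * r * e13
    have e' : (l * a - l ^ 2 - a * p) * (l * b - l ^ 2 - b * s) - a * b * q * r = 0 := by
      simpa [hx, hy] using e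
    have e'' : (a - b) ^ 2 * (l - a) * (l - b) * (l ^ 2 + a * b) = 0 := by
      linear_combination (a - b) ^ 2 * e' - a * (a - b) * (l * b - l ^ 2 - b * s) * hp +
        b * ((a - b) * (l * a - l ^ 2) + a * b ^ 2) * hs + a * b * hqr
    have h : l ^ 2 + a * b = 0 := by
      simpa [sub_ne_zero.2 hab, sub_ne_zero.2 hla, sub_ne_zero.2 hlb] using e''
    linear_combination h
  have hsum : l ^ 2 + a ^ 2 ≠ 0 := by
    rw [hl2, show -(a * b) + a ^ 2 = a * (a - b) by ring]
    exact mul_ne_zero ha (sub_ne_zero.2 hab)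
  refine ⟨.f14 l a b, ⟨hl, ha, hb, hla, hlb, hab, ?_⟩, ?_,
    pairEquiv_diagonal x 1 r hx one_ne_zero hr (by simp [mul_comm]) ?_⟩
  · rw [eq_div_iff ha]
    linear_combination hl2
  · intro h
    have : q * r * (a - b) ^ 2 * a = 0 := by
      linear_combination a * hqr - b * h + b * (l ^ 2 - a * b + a ^ 2) * hl2
    simp [hq, hr, ha, sub_ne_zero.2 hab] at this
  · refine ⟨⟨by ring, by ring, ?_⟩, ⟨by ring, ?_, ?_⟩, by ring, by ring, ?_⟩
    · rw [mul_div_assoc', eq_div_iff (mul_ne_zero hl hsum)]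
      clear * - e12 hp hl2 hb
      grind
    · rw [mul_div_assoc', eq_div_iff (mul_ne_zero ha hsum)]
      linear_combination p * a * hl2 - a ^ 2 * hp + (l ^ 2 - a * b) * hl2
    · rw [mul_div_assoc', eq_div_iff (pow_ne_zero 2 hsum)]
      clear * - hqr hl2
      grind
    · rw [mul_div_assoc', eq_div_iff hsum]
      clear * - hs hl2
      grind

/-- Three distinct eigenvalues and triangular `B`: the position of the zeros in `B` decides between
the families `f11`, `f12` and `f13`. -/
lemma classified_diag_of_upper {l a b x y p q s : K}
    (G : IsIndecBraidPair !![l, 0, 0; 0, a, 0; 0, 0, b] !![l, x, y; 0, p, q; 0, 0, s])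
    (hla : l ≠ a) (hlb : l ≠ b) (hab : a ≠ b) :
    Classified !![l, 0, 0; 0, a, 0; 0, 0, b] !![l, x, y; 0, p, q; 0, 0, s] := by
  obtain ⟨⟨e22, e23, e32, e33⟩, e12, e13⟩ := braid_entries G.braid
  obtain ⟨hl, ha, hb⟩ := diag_entries_ne_zero G
  have hdet := block_det_ne_zero G
  obtain ⟨hp, hs, -, hq⟩ | ⟨-, h, -⟩ := block_diag_cases ha hb hab hdet
    (by linear_combination e22) (by linear_combination e23) (by linear_combination e32)
    (by linear_combination e33)
  swap
  · exact absurd rfl h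
  subst hp hs
  have f12 : x * (l * p - l ^ 2 - p ^ 2) = 0 := by linear_combination e12
  have f13 : y * (l * s - l ^ 2 - s ^ 2) = x * p * q := by linear_combination e13
  by_cases hq0 : q = 0
  · subst hq0
    have hx : x ≠ 0 := by
      rintro rfl
      exact G.not_splits (splits_of_entries p 0 1 0 0 1 0 (by simp) (by simp) (by simp) (by simp)
        (by simp))
    have hy : y ≠ 0 := by
      rintro rfl
      exact G.not_splits (splits_of_entries s 0 0 1 0 0 1 (by simp) (by simp) (by simp) (by simp)
        (by simp))
    have h1 : l * p - l ^ 2 - p ^ 2 = 0 := by simpa [hx] using f12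
    have h2 : l * s - l ^ 2 - s ^ 2 = 0 := by simpa [hy] using f13
    refine ⟨.f11 l p s, ⟨hl, ha, hb, hla, hlb, hab, (exists_six_pair_iff hl).2
      ⟨by linear_combination -h1, ?_⟩⟩, trivial, pairEquiv_diagonal (x * y) y x (mul_ne_zero hx hy)
      hy hx (by simp [mul_comm]) (by simp [mul_comm])⟩
    apply mul_left_cancel₀ (sub_ne_zero.2 hab)
    linear_combination h2 - h1
  have h0 := hq (Or.inl hq0)
  by_cases hx : x = 0
  · subst hx
    have hy : y ≠ 0 := fun h => false_of_row_eq_zero G rfl h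
    have h2 : l * s - l ^ 2 - s ^ 2 = 0 := by simpa [hy] using f13
    refine ⟨.f12 l p s, ⟨hl, ha, hb, hla, hlb, hab, (exists_six_pair_iff hb).2
      ⟨by linear_combination -h2, ?_⟩⟩, trivial, pairEquiv_diagonal y q 1 hy hq0 one_ne_zero
      (by simp [mul_comm]) (by simp [mul_comm])⟩
    apply mul_left_cancel₀ (sub_ne_zero.2 hla)
    linear_combination -h2 - h0
  · have h1 : l * p - l ^ 2 - p ^ 2 = 0 := by simpa [hx] using f12
    have h3 : l + s = p := by
      apply mul_left_cancel₀ (sub_ne_zero.2 hlb)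
      linear_combination -h1 - h0
    subst h3
    have h4 : q * x = 2 * (l + s) * y := by
      apply mul_left_cancel₀ ha
      linear_combination -f13 + 3 * y * h1
    have hy : y ≠ 0 := by
      rintro rfl
      simp [hq0, hx] at h4
    refine ⟨.f13 l (l + s) s, ⟨hl, ha, hb, hla, hlb, hab, (exists_six_pair_iff ha).2
      ⟨by linear_combination -h1, rfl⟩⟩, trivial, pairEquiv_diagonal (x * y) y x (mul_ne_zero hx hy)
      hy hx (by simp [mul_comm]) ?_⟩
    refine ⟨⟨by ring, by ring, by ring⟩, ⟨by ring, by ring, ?_⟩, by ring, by ring, by ring⟩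
    linear_combination h4

lemma classified_diag {l a b x y p q r s : K}
    (G : IsIndecBraidPair !![l, 0, 0; 0, a, 0; 0, 0, b] !![l, x, y; 0, p, q; 0, r, s])
    (hla : l ≠ a) (hlb : l ≠ b) (hab : a ≠ b) :
    Classified !![l, 0, 0; 0, a, 0; 0, 0, b] !![l, x, y; 0, p, q; 0, r, s] := by
  by_cases hr : r = 0
  · subst hr
    exact classified_diag_of_upper G hla hlb hab
  by_cases hq : q = 0
  · subst hq
    exact (classified_diag_of_upper (G.of_pairEquiv pairEquiv_swap) hlb hla hab.symm).of_pairEquiv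
      pairEquiv_swap
  · exact classified_diag_of_irreducible G hla hlb hab hq hr

lemma classified_f31 {l a x y : K}
    (G : IsIndecBraidPair !![l, 0, 0; 0, a, 1; 0, 0, a] !![l, x, y; 0, a, 1; 0, 0, a])
    (hla : l ≠ a) :
    Classified !![l, 0, 0; 0, a, 1; 0, 0, a] !![l, x, y; 0, a, 1; 0, 0, a] := by
  obtain ⟨-, e12, e13⟩ := braid_entries G.braid
  obtain ⟨hl, ha, -⟩ := diag_entries_ne_zero G
  have f12 : x * (l * a - l ^ 2 - a ^ 2) = 0 := by linear_combination e12
  have f13 : y * (l * a - l ^ 2 - a ^ 2) = x * (2 * a - l) := by linear_combination e13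
  have hx : x = 0 := by
    by_contra hx
    have h1 : l * a - l ^ 2 - a ^ 2 = 0 := by simpa [hx] using f12
    rw [h1, mul_zero, eq_comm, mul_eq_zero, or_iff_right hx] at f13
    have : a ^ 2 * 3 = 0 := by linear_combination -h1 + (a + l) * f13
    simp [ha] at this
  subst hx
  have hy : y ≠ 0 := fun h => false_of_row_eq_zero G rfl h
  have h1 : l * a - l ^ 2 - a ^ 2 = 0 := by simpa [hy] using f13
  exact ⟨.f31 l a, ⟨hl, ha, hla, (exists_six_iff ha).2 (by linear_combination -h1)⟩, trivial,
    pairEquiv_diagonal y 1 1 hy one_ne_zero one_ne_zero (by simp [mul_comm]) (by simp [mul_comm])⟩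

lemma classified_f32 {l a x y : K}
    (G : IsIndecBraidPair !![l, 0, 0; 0, a, 1; 0, 0, a] !![l, x, y; 0, a, 0; 0, -a ^ 2, a])
    (hla : l ≠ a) :
    Classified !![l, 0, 0; 0, a, 1; 0, 0, a] !![l, x, y; 0, a, 0; 0, -a ^ 2, a] := by
  obtain ⟨-, e12, e13⟩ := braid_entries G.braid
  obtain ⟨hl, ha, -⟩ := diag_entries_ne_zero G
  have f12 : y * a ^ 3 = x * (l * (l - a)) := by linear_combination e12
  have f13 : x * (l - a) = y * (l ^ 2 + a ^ 2 - l * a) := by linear_combination e13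
  have hx : x ≠ 0 := by
    rintro rfl
    exact false_of_row_eq_zero G rfl (by simpa [ha] using f12)
  have h1 : a ^ 2 = - l ^ 2 := by
    have : x * (l - a) * ((l - a) * (l ^ 2 + a ^ 2)) = 0 := by
      linear_combination -(l ^ 2 + a ^ 2 - l * a) * f12 - a ^ 3 * f13
    have h : l ^ 2 + a ^ 2 = 0 := by simpa [hx, sub_ne_zero.2 hla] using this
    linear_combination h
  refine ⟨.f32 l a, ⟨hl, ha, hla, (exists_four_iff hl).2 h1⟩, trivial,
    pairEquiv_diagonal x 1 1 hx one_ne_zero one_ne_zero (by simp [mul_comm]) ?_⟩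
  refine ⟨⟨by ring, by ring, ?_⟩, ⟨by ring, by ring, by ring⟩, by ring, by linear_combination -h1,
    by ring⟩
  rw [mul_div_assoc', eq_div_iff (pow_ne_zero 2 hl)]
  apply mul_left_cancel₀ ha
  linear_combination -f12 + (y * a - x) * h1

/-- `A` has a double eigenvalue with a Jordan block, different from the one on the invariant
line. -/
lemma classified_jordan_right {l a x y p q r s : K} (hla : l ≠ a)
    (G : IsIndecBraidPair !![l, 0, 0; 0, a, 1; 0, 0, a] !![l, x, y; 0, p, q; 0, r, s]) :
    Classified !![l, 0, 0; 0, a, 1; 0, 0, a] !![l, x, y; 0, p, q; 0, r, s] := by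
  obtain ⟨⟨e22, e23, e32, e33⟩, -⟩ := braid_entries G.braid
  obtain ⟨hl, ha, -⟩ := diag_entries_ne_zero G
  obtain ⟨rfl, rfl, rfl, rfl⟩ | ⟨rfl, rfl, hq⟩ := block_jordan_cases ha (block_det_ne_zero G)
    (by linear_combination e22) (by linear_combination e23) (by linear_combination e32)
    (by linear_combination e33)
  · exact classified_f31 G hla
  -- adding a multiple of `e₂` to `e₃` commutes with `A` and makes the diagonal of `B` constant
  · have key : PairEquiv !![l, 0, 0; 0, a, 1; 0, 0, a] !![l, x, y; 0, p, q; 0, -a ^ 2, 2 * a - p]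
        !![l, 0, 0; 0, a, 1; 0, 0, a] !![l, x, y + (a - p) / a ^ 2 * x; 0, a, 0; 0, -a ^ 2, a] := by
      refine pairEquiv_of_entries 1 0 0 0 1 ((a - p) / a ^ 2) 0 0 1 (by simp) ?_ ?_
      · simp only [mul_fin_three, matrix_three_eq_iff]
        refine ⟨⟨?_, ?_, ?_⟩, ⟨?_, ?_, ?_⟩, ?_, ?_, ?_⟩ <;> ring
      · simp only [mul_fin_three, matrix_three_eq_iff]
        refine ⟨⟨?_, ?_, ?_⟩, ⟨?_, ?_, ?_⟩, ?_, ?_, ?_⟩ <;> field_simp <;> try ring1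
        linear_combination hq
    exact (classified_f32 (G.of_pairEquiv key) hla).of_pairEquiv key

end Classification

/-! ### First eigenvalue repeated -/

section Classification

variable {K : Type*} [Field K]

/-- If `A` is scalar on the quotient with the same eigenvalue as on the line, then `A = B`, and an
invariant complement exists. -/
lemma not_isIndecBraidPair_of_eq {l u v x y p q r s : K}
    (G : IsIndecBraidPair !![l, u, v; 0, l, 0; 0, 0, l] !![l, x, y; 0, p, q; 0, r, s]) :
    False := by
  obtain ⟨⟨e22, e23, e32, e33⟩, e12, e13⟩ := braid_entries G.braid
  obtain ⟨hl, -, -⟩ := diag_entries_ne_zero G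
  have hl2 := pow_ne_zero 2 hl
  obtain ⟨rfl, rfl, rfl, rfl⟩ := block_scalar_eq hl (block_det_ne_zero G)
    (by linear_combination e22) (by linear_combination e23) (by linear_combination e32)
    (by linear_combination e33)
  have hx : u = x := mul_left_cancel₀ hl2 (by linear_combination e12)
  have hy : v = y := mul_left_cancel₀ hl2 (by linear_combination e13)
  subst hx hy
  by_cases hv : v = 0
  · subst hv
    by_cases hu : u = 0
    · subst hu
      exact false_of_row_eq_zero G rfl rfl
    · exact G.not_splits (splits_of_entries s 0 0 (-u) 0 0 1 (by simp) (by simp) (by simp) (by simp)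
        (by simpa using hu))
  · exact G.not_splits (splits_of_entries s 0 v (-u) 0 1 0 (by simp; ring) (by simp; ring) (by simp)
      (by simp) (by simpa using hv))

variable [CharZero K]

lemma classified_f2 {l b x y p q r s : K} (hlb : l ≠ b)
    (G : IsIndecBraidPair !![l, 0, 0; 0, l, 0; 0, 0, b] !![l, x, y; 0, p, q; 0, r, s]) :
    Classified !![l, 0, 0; 0, l, 0; 0, 0, b] !![l, x, y; 0, p, q; 0, r, s] := by
  obtain ⟨⟨e22, e23, e32, e33⟩, e12, e13⟩ := braid_entries G.braid
  obtain ⟨-, hl, hb⟩ := diag_entries_ne_zero G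
  have f12 : x * l * p = - (y * b * r) := by linear_combination -e12
  have f13 : y * (l * b - l ^ 2 - b * s) = x * l * q := by linear_combination e13
  obtain ⟨hp, hs, hqr, h0⟩ | ⟨hq, hr, hp, hs, hqr⟩ := block_diag_cases hl hb hlb
    (block_det_ne_zero G)
    (by linear_combination e22) (by linear_combination e23) (by linear_combination e32)
    (by linear_combination e33)
  · subst hp hs
    by_cases hr : r = 0
    · subst hr
      have hx : x = 0 := by simpa [hl] using f12
      subst hx
      exfalso
      by_cases hq : q = 0
      · subst hq
        exact G.not_splits (splits_of_entries p 0 1 0 0 1 0 (by simp) (by simp) (by simp) (by simp)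
          (by simp))
      · exact G.not_splits (splits_of_entries p 1 0 0 q (-y) 0 (by simp) (by simp)
          (by simp [mul_comm]) (by refine ⟨?_, ?_, ?_⟩ <;> ring) (by simpa using hq))
    · have hq : q = 0 := by simpa [hr] using hqr
      subst hq
      have h1 := h0 (Or.inr hr)
      have hy : y ≠ 0 := fun hy => false_of_row_eq_zero G (by simpa [hl, hy] using f12) hy
      have hx : x ≠ 0 := by
        rintro rfl
        simp [hy, hb, hr] at f12
      have hd : p - s ≠ 0 := sub_ne_zero.2 hlb
      have hd' : s - p ≠ 0 := sub_ne_zero.2 hlb.symm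
      refine ⟨.f2 p s, ⟨hl, hb, hlb, (exists_six_iff hb).2 h1⟩, trivial,
        pairEquiv_diagonal x 1 r hx one_ne_zero hr (by simp [mul_comm]) ?_⟩
      refine ⟨⟨by ring, by ring, ?_⟩, ⟨by ring, ?_, by ring⟩, by ring, by ring, ?_⟩
      · rw [mul_div_assoc', eq_div_iff hd]
        apply mul_left_cancel₀ hb
        linear_combination (p - s) * f12 - x * p * h1
      · rw [one_mul, mul_one, eq_div_iff hd']
        linear_combination -h1
      · rw [mul_div_assoc', eq_div_iff hd]
        linear_combination -r * h1
  · exfalso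
    refine G.not_splits (splits_of_entries l 1 0 0 q (-y) 0 (by simp) (by simp)
          (by simp [mul_comm]) ⟨by ring, ?_, by ring⟩ (by simpa using hq))
    apply mul_left_cancel₀ (mul_ne_zero hl (sub_ne_zero.2 hlb))
    linear_combination -(l - b) * f13 - b * y * hs + y * l * hp

/-- `A` has a Jordan block containing the invariant line, and the quotient is irreducible. -/
lemma classified_f42 {l b x p q r s : K} (hlb : l ≠ b)
    (hq : q ≠ 0) (hp : p * (b - l) = b ^ 2) (hs : s * (l - b) = l ^ 2)
    (hqr : q * r * (l - b) ^ 2 = - (l * b * (l ^ 2 - l * b + b ^ 2)))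
    (G : IsIndecBraidPair !![l, 1, 0; 0, l, 0; 0, 0, b] !![l, x, 0; 0, p, q; 0, r, s]) :
    Classified !![l, 1, 0; 0, l, 0; 0, 0, b] !![l, x, 0; 0, p, q; 0, r, s] := by
  obtain ⟨-, e12, e13⟩ := braid_entries G.braid
  obtain ⟨-, hl, hb⟩ := diag_entries_ne_zero G
  have f12 : x * l * p = l ^ 2 := by linear_combination -e12
  have f13 : x * l = b - l := mul_left_cancel₀ hq (by linear_combination -e13)
  have h1 : l = -b := by
    apply mul_left_cancel₀ (sub_ne_zero.2 hlb)
    linear_combination -f12 + p * f13 + hp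
  subst h1
  have hp' : p = b / 2 := by
    field_simp
    apply mul_left_cancel₀ hb
    linear_combination hp
  have hs' : s = -b / 2 := by
    field_simp
    apply mul_left_cancel₀ hb
    linear_combination -hs
  have hx : x = -2 := by
    apply mul_left_cancel₀ hb
    linear_combination -f13
  have hr : r * q = 3 * b ^ 2 / 4 := by
    field_simp
    apply mul_left_cancel₀ (pow_ne_zero 2 hb)
    linear_combination hqr
  refine ⟨.f42 (-b) b, ⟨hl, hb, hlb, rfl⟩, trivial, pairEquiv_diagonal q q 1 hq hq one_ne_zero
    (by simp [mul_comm]) ?_⟩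
  rw [hp', hs', hx]
  exact ⟨⟨by ring, by ring, by ring⟩, ⟨by ring, by ring, by ring⟩, by ring,
    by linear_combination hr, by ring⟩

/-- The Jordan block of `A` contains the invariant line. The families `f41` and `f42` appear, and
also `f31` when the basis vectors have to be permuted. -/
lemma classified_jordan_left {l b x y p q r s : K} (hlb : l ≠ b)
    (G : IsIndecBraidPair !![l, 1, 0; 0, l, 0; 0, 0, b] !![l, x, y; 0, p, q; 0, r, s]) :
    Classified !![l, 1, 0; 0, l, 0; 0, 0, b] !![l, x, y; 0, p, q; 0, r, s] := by
  obtain ⟨⟨e22, e23, e32, e33⟩, e12, e13⟩ := braid_entries G.braid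
  obtain ⟨-, hl, hb⟩ := diag_entries_ne_zero G
  have hl2 := pow_ne_zero 2 hl
  have f12 : x * l * p + y * b * r = l ^ 2 := by linear_combination -e12
  have f13 : y * (l * b - l ^ 2 - b * s) = x * l * q + q * (l - b) := by linear_combination e13
  obtain ⟨hp, hs, hqr, h0⟩ | ⟨hq, hr, hp, hs, hqr⟩ := block_diag_cases hl hb hlb
    (block_det_ne_zero G)
    (by linear_combination e22) (by linear_combination e23) (by linear_combination e32)
    (by linear_combination e33)
  · subst hp hs
    by_cases hq : q = 0
    · subst hq
      by_cases hy : y = 0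
      · subst hy
        have hx : x = 1 := mul_left_cancel₀ hl2 (by linear_combination f12)
        subst hx
        have hr : r ≠ 0 := by
          rintro rfl
          exact G.not_splits (splits_of_entries s 0 0 1 0 0 1 (by simp) (by simp) (by simp)
            (by simp) (by simp))
        have h1 := h0 (Or.inr hr)
        refine ⟨.f31 s p, ⟨hb, hl, hlb.symm, (exists_six_iff hl).2 (by linear_combination h1)⟩,
          trivial, pairEquiv_of_entries 0 1 0 0 0 1 r 0 0 (by simpa using hr) ?_ ?_⟩
        · simp [mul_comm]
        · simp [mul_comm]
      · have h1 : p ^ 2 - p * s + s ^ 2 = 0 := mul_left_cancel₀ hy (by linear_combination -f13)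
        refine ⟨.f41 p s (r * y), ⟨hl, hb, hlb, (exists_six_iff hb).2 h1⟩, trivial,
          pairEquiv_diagonal y y 1 hy hy one_ne_zero (by simp [mul_comm]) ?_⟩
        refine ⟨⟨by ring, ?_, by ring⟩, ⟨by ring, by ring, by ring⟩, by ring, by ring, by ring⟩
        field_simp
        apply mul_left_cancel₀ hl2
        linear_combination s ^ 2 * f12 - y * r * (p + s) * h1
    · have hr : r = 0 := by simpa [hq] using hqr
      subst hr
      exfalso
      have h1 := h0 (Or.inl hq)
      have hx : x = 1 := mul_left_cancel₀ hl2 (by linear_combination f12)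
      subst hx
      have h2 : s = 2 * p := mul_left_cancel₀ hq (by linear_combination f13 + y * h1)
      subst h2
      have : p ^ 2 * 3 = 0 := by linear_combination h1
      simp [hl] at this
  -- conjugating by a polynomial in the Jordan block clears the last entry of the first row
  · have key : PairEquiv !![l, 1, 0; 0, l, 0; 0, 0, b] !![l, x, y; 0, p, q; 0, r, s]
        !![l, 1, 0; 0, l, 0; 0, 0, b] !![l, x + y / q * (l - p), 0; 0, p, q; 0, r, s] := by
      refine pairEquiv_of_entries 1 (y / q) 0 0 1 0 0 0 1 (by simp) ?_ ?_
      · simp only [mul_fin_three, matrix_three_eq_iff]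
        refine ⟨⟨?_, ?_, ?_⟩, ⟨?_, ?_, ?_⟩, ?_, ?_, ?_⟩ <;> ring
      · simp only [mul_fin_three, matrix_three_eq_iff]
        refine ⟨⟨?_, ?_, ?_⟩, ⟨?_, ?_, ?_⟩, ?_, ?_, ?_⟩ <;> field_simp <;> ring
    exact (classified_f42 hlb hq hp hs hqr (G.of_pairEquiv key)).of_pairEquiv key

/-- `A` has a single eigenvalue and its quotient block is a Jordan block. -/
lemma classified_f5 {l u v x y p q r s : K}
    (G : IsIndecBraidPair !![l, u, v; 0, l, 1; 0, 0, l] !![l, x, y; 0, p, q; 0, r, s]) :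
    Classified !![l, u, v; 0, l, 1; 0, 0, l] !![l, x, y; 0, p, q; 0, r, s] := by
  obtain ⟨⟨e22, e23, e32, e33⟩, e12, e13⟩ := braid_entries G.braid
  obtain ⟨hl, -, -⟩ := diag_entries_ne_zero G
  have hl2 := pow_ne_zero 2 hl
  obtain ⟨rfl, rfl, rfl, rfl⟩ | ⟨rfl, rfl, hq⟩ := block_jordan_cases hl (block_det_ne_zero G)
    (by linear_combination e22) (by linear_combination e23) (by linear_combination e32)
    (by linear_combination e33)
  · have hx : u = x := mul_left_cancel₀ hl2 (by linear_combination e12)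
    subst hx
    have hy : v = y := mul_left_cancel₀ hl2 (by linear_combination e13)
    subst hy
    have hu : u ≠ 0 := by
      rintro rfl
      refine G.not_splits (splits_of_entries s 1 0 0 1 (-v) 0 (by simp) (by simp)
        (by simp [mul_comm]) (by simp [mul_comm]) (by simp))
    refine ⟨.f5 s, hl, trivial, pairEquiv_of_entries u v 0 0 1 0 0 0 1 (by simpa using hu) ?_ ?_⟩
    · simp [mul_comm, add_comm]
    · simp [mul_comm, add_comm]
  · exfalso
    have f12 : l * u = x * (p - l) - y * l ^ 2 := mul_left_cancel₀ hl (by linear_combination e12)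
    have hu : u = 0 := by
      apply mul_left_cancel₀ (mul_ne_zero two_ne_zero hl2)
      linear_combination l * e13 + x * hq - (p - 2 * l) * f12
    subst hu
    refine G.not_splits (splits_of_entries l 1 0 0 1 (-v) ((x - v * (p - l)) / l ^ 2) (by simp)
      (by simp) (by simp [mul_comm]) ⟨by ring, ?_, ?_⟩ (by simp))
    · field_simp
      ring
    · field_simp
      linear_combination f12 - v * hq

/-- `A` is triangular with diagonal `(l, l, b)` and `l ≠ b`; it is diagonalizable exactly when
`u = 0`. -/
lemma classified_of_eq_of_ne {l u v b c x y p q r s : K} (hlb : l ≠ b)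
    (G : IsIndecBraidPair !![l, u, v; 0, l, c; 0, 0, b] !![l, x, y; 0, p, q; 0, r, s]) :
    Classified !![l, u, v; 0, l, c; 0, 0, b] !![l, x, y; 0, p, q; 0, r, s] := by
  have hd : b - l ≠ 0 := sub_ne_zero.2 hlb.symm
  by_cases hu : u = 0
  · subst hu
    obtain ⟨x', y', p', q', r', s', h⟩ := exists_pairEquiv_of_mul_eq (x := x) (y := y) (p := p)
      (q := q) (r := r) (s := s) (l := l) (A := !![l, 0, v; 0, l, c; 0, 0, b])
      (A' := !![l, 0, 0; 0, l, 0; 0, 0, b]) (m₂ := 0) (m₃ := v / (b - l)) (m₅ := 1)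
      (m₆ := c / (b - l)) (m₈ := 0) (m₉ := 1) (by simp) (by
        simp only [mul_fin_three, matrix_three_eq_iff]
        refine ⟨⟨?_, ?_, ?_⟩, ⟨?_, ?_, ?_⟩, ?_, ?_, ?_⟩ <;> field_simp <;> ring)
    exact (classified_f2 hlb (G.of_pairEquiv h)).of_pairEquiv h
  · obtain ⟨x', y', p', q', r', s', h⟩ := exists_pairEquiv_of_mul_eq (x := x) (y := y) (p := p)
      (q := q) (r := r) (s := s) (l := l) (A := !![l, u, v; 0, l, c; 0, 0, b])
      (A' := !![l, 1, 0; 0, l, 0; 0, 0, b]) (m₂ := 0)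
      (m₃ := (u * (c / (b - l)) + v) / (b - l)) (m₅ := u⁻¹)
      (m₆ := c / (b - l)) (m₈ := 0) (m₉ := 1) (by simpa using hu) (by
        simp only [mul_fin_three, matrix_three_eq_iff]
        refine ⟨⟨?_, ?_, ?_⟩, ⟨?_, ?_, ?_⟩, ?_, ?_, ?_⟩ <;> field_simp <;> ring)
    exact (classified_jordan_left hlb (G.of_pairEquiv h)).of_pairEquiv h

/-! ### Reduction to the normal forms of the first matrix -/

lemma classified_of_upper {l u v a b c x y p q r s : K}
    (G : IsIndecBraidPair !![l, u, v; 0, a, c; 0, 0, b] !![l, x, y; 0, p, q; 0, r, s]) :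
    Classified !![l, u, v; 0, a, c; 0, 0, b] !![l, x, y; 0, p, q; 0, r, s] := by
  by_cases hla : l = a
  · subst hla
    by_cases hlb : l = b
    · subst hlb
      by_cases hc : c = 0
      · subst hc
        exact (not_isIndecBraidPair_of_eq G).elim
      · obtain ⟨x', y', p', q', r', s', h⟩ := exists_pairEquiv_of_mul_eq (x := x) (y := y) (p := p)
          (q := q) (r := r) (s := s) (l := l) (A := !![l, u, v; 0, l, c; 0, 0, l])
          (A' := !![l, u * c, v; 0, l, 1; 0, 0, l]) (m₂ := 0) (m₃ := 0) (m₅ := c)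
          (m₆ := 0) (m₈ := 0) (m₉ := 1) (by simpa using hc) (by simp [mul_comm])
        exact (classified_f5 (G.of_pairEquiv h)).of_pairEquiv h
    · exact classified_of_eq_of_ne hlb G
  have hd : a - l ≠ 0 := sub_ne_zero.2 (Ne.symm hla)
  have hd' : l - a ≠ 0 := sub_ne_zero.2 hla
  by_cases hlb : l = b
  · subst hlb
    obtain ⟨x', y', p', q', r', s', h⟩ := exists_pairEquiv_of_mul_eq (x := x) (y := y) (p := p)
      (q := q) (r := r) (s := s) (l := l) (A := !![l, u, v; 0, a, c; 0, 0, l])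
      (A' := !![l, u * (c / (l - a)) + v, u; 0, l, 0; 0, 0, a]) (m₂ := 0) (m₃ := 0)
      (m₅ := c / (l - a)) (m₆ := 1) (m₈ := 1) (m₉ := 0) (by simp) (by
        simp only [mul_fin_three, matrix_three_eq_iff]
        refine ⟨⟨?_, ?_, ?_⟩, ⟨?_, ?_, ?_⟩, ?_, ?_, ?_⟩ <;> field_simp <;> ring)
    exact (classified_of_eq_of_ne hla (G.of_pairEquiv h)).of_pairEquiv h
  have hb : b - l ≠ 0 := sub_ne_zero.2 (Ne.symm hlb)
  by_cases hab : a = b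
  · subst hab
    by_cases hc : c = 0
    · subst hc
      obtain ⟨x', y', p', q', r', s', h⟩ := exists_pairEquiv_of_mul_eq (x := x) (y := y) (p := p)
        (q := q) (r := r) (s := s) (l := l) (A := !![l, u, v; 0, a, 0; 0, 0, a])
        (A' := !![l, 0, 0; 0, a, 0; 0, 0, a]) (m₂ := u / (a - l)) (m₃ := v / (a - l))
        (m₅ := 1) (m₆ := 0) (m₈ := 0) (m₉ := 1) (by simp) (by
          simp only [mul_fin_three, matrix_three_eq_iff]
          refine ⟨⟨?_, ?_, ?_⟩, ⟨?_, ?_, ?_⟩, ?_, ?_, ?_⟩ <;> field_simp <;> ring)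
      exact (not_isIndecBraidPair_scalar (G.of_pairEquiv h)).elim
    · obtain ⟨x', y', p', q', r', s', h⟩ := exists_pairEquiv_of_mul_eq (x := x) (y := y) (p := p)
        (q := q) (r := r) (s := s) (l := l) (A := !![l, u, v; 0, a, c; 0, 0, a])
        (A' := !![l, 0, 0; 0, a, 1; 0, 0, a]) (m₂ := c * (u / (a - l)))
        (m₃ := (v - c * (u / (a - l))) / (a - l))
        (m₅ := c) (m₆ := 0) (m₈ := 0) (m₉ := 1) (by simpa using hc) (by
          simp only [mul_fin_three, matrix_three_eq_iff]
          refine ⟨⟨?_, ?_, ?_⟩, ⟨?_, ?_, ?_⟩, ?_, ?_, ?_⟩ <;> field_simp <;> ring)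
      exact (classified_jordan_right hla (G.of_pairEquiv h)).of_pairEquiv h
  have hba : b - a ≠ 0 := sub_ne_zero.2 (Ne.symm hab)
  obtain ⟨x', y', p', q', r', s', h⟩ := exists_pairEquiv_of_mul_eq (x := x) (y := y) (p := p)
    (q := q) (r := r) (s := s) (l := l) (A := !![l, u, v; 0, a, c; 0, 0, b])
    (A' := !![l, 0, 0; 0, a, 0; 0, 0, b]) (m₂ := u / (a - l))
    (m₃ := (u * (c / (b - a)) + v) / (b - l))
    (m₅ := 1) (m₆ := c / (b - a)) (m₈ := 0) (m₉ := 1) (by simp) (by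
      simp only [mul_fin_three, matrix_three_eq_iff]
      refine ⟨⟨?_, ?_, ?_⟩, ⟨?_, ?_, ?_⟩, ?_, ?_, ?_⟩ <;> field_simp <;> ring)
  exact (classified_diag (G.of_pairEquiv h) hla hlb hab).of_pairEquiv h

/-- Over an algebraically closed field the quotient block of `A` has an eigenvector, so `A` may be
taken upper triangular. -/
theorem classified_of_common_eigenvector [IsAlgClosed K] {l u v a b c d x y p q r s : K}
    (G : IsIndecBraidPair !![l, u, v; 0, a, c; 0, d, b] !![l, x, y; 0, p, q; 0, r, s]) :
    Classified !![l, u, v; 0, a, c; 0, d, b] !![l, x, y; 0, p, q; 0, r, s] := by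
  by_cases hd : d = 0
  · subst hd
    exact classified_of_upper G
  -- `(t, 1)` is an eigenvector of the block with eigenvalue `d * t + b`
  obtain ⟨z, hz⟩ := IsAlgClosed.exists_eq_mul_self (discrim d (b - a) (-c))
  obtain ⟨t, ht⟩ := exists_quadratic_eq_zero hd ⟨z, hz⟩
  obtain ⟨x', y', p', q', r', s', h⟩ := exists_pairEquiv_of_mul_eq (x := x) (y := y) (p := p)
    (q := q) (r := r) (s := s) (l := l) (A := !![l, u, v; 0, a, c; 0, d, b])
    (A' := !![l, u * t + v, u; 0, d * t + b, d; 0, 0, a - t * d]) (m₂ := 0) (m₃ := 0)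
    (m₅ := t) (m₆ := 1) (m₈ := 1) (m₉ := 0) (by simp) (by
      simp only [mul_fin_three, matrix_three_eq_iff]
      refine ⟨⟨?_, ?_, ?_⟩, ⟨?_, ?_, ?_⟩, ?_, ?_, ?_⟩ <;> try ring1
      linear_combination -ht)
  exact (classified_of_upper (G.of_pairEquiv h)).of_pairEquiv h

end Classification

/-! ### Invariant lines and planes of the listed pairs -/

section Families

variable {K : Type*} [Field K]

/-- The scalars by which the pair acts on its invariant lines. Applied to the transposed pair, it
gives the scalars on the one-dimensional quotients. -/
def socle (A B : Matrix (Fin 3) (Fin 3) K) : Set K := {c | ∃ v, IsEigenline A B c v}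

namespace B3Form

/-- The second matrix of the family `f14`, with `l₁ ^ 2 = -l₂ * l₃` used to write the entries in
terms of the eigenvalue differences. -/
lemma matB_f14_eq {l a b : K} (h : (f14 l a b).Admissible) :
    (f14 l a b).matB = !![l, 1, a ^ 2 * (l + b - a) / (l * (a - b));
      0, b ^ 2 / (b - a), - (a * b * (a ^ 2 - a * b + b ^ 2)) / (a - b) ^ 2;
      0, 1, a ^ 2 / (a - b)] := by
  obtain ⟨hl, ha, hb, hla, hlb, hab, h3⟩ := h
  rw [eq_div_iff ha] at h3
  have hl2 : l ^ 2 = - (a * b) := by linear_combination h3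
  have hd : a - b ≠ 0 := sub_ne_zero.2 hab
  have hd' : b - a ≠ 0 := sub_ne_zero.2 hab.symm
  have hsum : l ^ 2 + a ^ 2 = a * (a - b) := by linear_combination hl2
  simp only [matB, matrix_three_eq_iff, hsum]
  refine ⟨⟨trivial, trivial, ?_⟩, ⟨trivial, ?_, ?_⟩, trivial, trivial, ?_⟩
  · field_simp
    linear_combination -hl2
  · field_simp
    linear_combination (a - b) * (l ^ 2 - a * b) * hl2
  · field_simp
    linear_combination (l ^ 4 + l ^ 2 * a ^ 2 + a ^ 4 - a * b * (l ^ 2 - a * b + a ^ 2)) * hl2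
  · field_simp

variable {c : K} {v : Fin 3 → K}

lemma eigenline_f11 {l a b : K} (h : (f11 l a b).Admissible)
    (hv : IsEigenline (f11 l a b).matA (f11 l a b).matB c v) : c = l ∧ v 1 = 0 ∧ v 2 = 0 := by
  obtain ⟨hl, ha, hb, hla, hlb, hab, -⟩ := h
  obtain ⟨h0, hA, hB⟩ := isEigenline_iff.1 hv
  simp at hA hB
  grind

lemma coeigenline_f11 {l a b : K} (h : (f11 l a b).Admissible)
    (hv : IsEigenline (f11 l a b).matAᵀ (f11 l a b).matBᵀ c v) :
    v 0 = 0 ∧ (c = a ∧ v 2 = 0 ∨ c = b ∧ v 1 = 0) := by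
  obtain ⟨hl, ha, hb, hla, hlb, hab, -⟩ := h
  obtain ⟨h0, hA, hB⟩ := isEigenline_transpose_iff.1 hv
  simp at hA hB
  grind

lemma eigenline_f12 {l a b : K} (h : (f12 l a b).Admissible)
    (hv : IsEigenline (f12 l a b).matA (f12 l a b).matB c v) :
    v 2 = 0 ∧ (c = l ∧ v 1 = 0 ∨ c = a ∧ v 0 = 0) := by
  obtain ⟨hl, ha, hb, hla, hlb, hab, -⟩ := h
  obtain ⟨h0, hA, hB⟩ := isEigenline_iff.1 hv
  simp at hA hB
  grind

lemma coeigenline_f12 {l a b : K} (h : (f12 l a b).Admissible)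
    (hv : IsEigenline (f12 l a b).matAᵀ (f12 l a b).matBᵀ c v) :
    c = b ∧ v 0 = 0 ∧ v 1 = 0 := by
  obtain ⟨hl, ha, hb, hla, hlb, hab, -⟩ := h
  obtain ⟨h0, hA, hB⟩ := isEigenline_transpose_iff.1 hv
  simp at hA hB
  grind

lemma eigenline_f13 {l a b : K} (h : (f13 l a b).Admissible)
    (hv : IsEigenline (f13 l a b).matA (f13 l a b).matB c v) : c = l ∧ v 1 = 0 ∧ v 2 = 0 := by
  obtain ⟨hl, ha, hb, hla, hlb, hab, -⟩ := h
  obtain ⟨h0, hA, hB⟩ := isEigenline_iff.1 hv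
  simp at hA hB
  grind

lemma coeigenline_f13 [CharZero K] {l a b : K} (h : (f13 l a b).Admissible)
    (hv : IsEigenline (f13 l a b).matAᵀ (f13 l a b).matBᵀ c v) :
    c = b ∧ v 0 = 0 ∧ v 1 = 0 := by
  obtain ⟨hl, ha, hb, hla, hlb, hab, -⟩ := h
  obtain ⟨h0, hA, hB⟩ := isEigenline_transpose_iff.1 hv
  simp at hA hB
  grind

/-- The condition of `NoOverlap` in terms of `l₂` and `l₃`. -/
lemma f14_ne_zero {l a b : K} (h : (f14 l a b).Admissible) (h' : (f14 l a b).NoOverlap) :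
    a ^ 2 - a * b + b ^ 2 ≠ 0 := by
  obtain ⟨hl, ha, hb, hla, hlb, hab, h3⟩ := h
  rw [eq_div_iff ha] at h3
  intro h0
  apply h'
  linear_combination (l ^ 2 - a * b + a ^ 2) * h3 + a ^ 2 * h0

/-- Here the `(2, 3)` entry of `B` may vanish, so the eigenvectors are treated case by case. -/
lemma not_splits_f14 {l a b : K} (h : (f14 l a b).Admissible) :
    ¬ Splits (f14 l a b).matA (f14 l a b).matB := by
  rintro ⟨c, v, w, hv, hw, hvw⟩
  obtain ⟨hl, ha, hb, hla, hlb, hab, h3⟩ := h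
  obtain ⟨h0, hA, hB⟩ := isEigenline_iff.1 hv
  obtain ⟨h0', hA', hB'⟩ := isEigenline_transpose_iff.1 hw
  apply hvw
  simp only [dotProduct, Fin.sum_univ_three]
  clear hv hw hvw h3
  generalize -a ^ 2 * (l ^ 2 - l * a + a ^ 2) / (l * (l ^ 2 + a ^ 2)) = X at *
  generalize -l ^ 4 / (a * (l ^ 2 + a ^ 2)) = Y at *
  generalize a ^ 3 / (l ^ 2 + a ^ 2) = Z at *
  generalize l ^ 2 * (l ^ 4 + l ^ 2 * a ^ 2 + a ^ 4) / (l ^ 2 + a ^ 2) ^ 2 = W at *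
  simp at hA hB hA' hB'
  obtain ⟨-, -, hB⟩ := hB
  obtain ⟨-, hB', -⟩ := hB'
  by_cases h1 : c = l
  · subst h1
    simp [hla.symm, hlb.symm] at hA hA'
    simp [hA, hA'] at hB' ⊢
    simp [hB']
  · simp [Ne.symm h1] at hA hA'
    by_cases h2 : c = a
    · subst h2
      simp [hab.symm] at hA hA'
      simp [hA, hA'] at hB ⊢
      simp [hB]
    · simp [Ne.symm h2] at hA hA'
      simp [hA, hA'] at hB' ⊢
      simp [hB']

lemma eigenline_f14 {l a b : K} (h : (f14 l a b).Admissible) (h' : (f14 l a b).NoOverlap)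
    (hv : IsEigenline (f14 l a b).matA (f14 l a b).matB c v) : c = l ∧ v 1 = 0 ∧ v 2 = 0 := by
  have hn := f14_ne_zero h h'
  rw [matB_f14_eq h] at hv
  obtain ⟨hl, ha, hb, hla, hlb, hab, h3⟩ := h
  obtain ⟨h0, hA, hB⟩ := isEigenline_iff.1 hv
  have hx : - (a * b * (a ^ 2 - a * b + b ^ 2)) / (a - b) ^ 2 ≠ 0 := by
    simp [ha, hb, hn, sub_ne_zero.2 hab]
  generalize - (a * b * (a ^ 2 - a * b + b ^ 2)) / (a - b) ^ 2 = X at *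
  generalize a ^ 2 * (l + b - a) / (l * (a - b)) = Y at *
  generalize b ^ 2 / (b - a) = Z at *
  generalize a ^ 2 / (a - b) = W at *
  clear h3 h' hv hn
  simp at hA hB
  grind

lemma coeigenline_f14 {l a b : K} (h : (f14 l a b).Admissible) (h' : (f14 l a b).NoOverlap)
    (hv : IsEigenline (f14 l a b).matAᵀ (f14 l a b).matBᵀ c v) : False := by
  have hn := f14_ne_zero h h'
  rw [matB_f14_eq h] at hv
  obtain ⟨hl, ha, hb, hla, hlb, hab, h3⟩ := h
  obtain ⟨h0, hA, hB⟩ := isEigenline_transpose_iff.1 hv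
  have hx : - (a * b * (a ^ 2 - a * b + b ^ 2)) / (a - b) ^ 2 ≠ 0 := by
    simp [ha, hb, hn, sub_ne_zero.2 hab]
  generalize - (a * b * (a ^ 2 - a * b + b ^ 2)) / (a - b) ^ 2 = X at *
  generalize a ^ 2 * (l + b - a) / (l * (a - b)) = Y at *
  generalize b ^ 2 / (b - a) = Z at *
  generalize a ^ 2 / (a - b) = W at *
  clear h3 h' hv hn
  simp at hA hB
  grind

/-- The sixth root relation `l₁ ^ 2 - l₁ * l₂ + l₂ ^ 2 = 0` removes the denominators. -/
lemma matB_f2_eq [CharZero K] {l a : K} (h : (f2 l a).Admissible) :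
    (f2 l a).matB = !![l, 1, -l ^ 2 / a; 0, l, 0; 0, 1, a] := by
  obtain ⟨hl, ha, hla, h⟩ := h
  rw [exists_six_iff ha] at h
  have hd : l - a ≠ 0 := sub_ne_zero.2 hla
  have hd' : a - l ≠ 0 := sub_ne_zero.2 hla.symm
  simp only [matB, matrix_three_eq_iff]
  refine ⟨⟨trivial, trivial, ?_⟩, ⟨trivial, ?_, trivial⟩, trivial, trivial, ?_⟩
  · field_simp
    linear_combination h
  · field_simp
    linear_combination h
  · field_simp
    linear_combination h

lemma eigenline_f2 [CharZero K] {l a : K} (h : (f2 l a).Admissible)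
    (hv : IsEigenline (f2 l a).matA (f2 l a).matB c v) : c = l ∧ v 1 = 0 ∧ v 2 = 0 := by
  rw [matB_f2_eq h] at hv
  obtain ⟨hl, ha, hla, -⟩ := h
  obtain ⟨h0, hA, hB⟩ := isEigenline_iff.1 hv
  have hx : -l ^ 2 / a ≠ 0 := by simp [hl, ha]
  generalize -l ^ 2 / a = X at *
  clear hv
  simp at hA hB
  grind

lemma coeigenline_f2 [CharZero K] {l a : K} (h : (f2 l a).Admissible)
    (hv : IsEigenline (f2 l a).matAᵀ (f2 l a).matBᵀ c v) : c = l ∧ v 0 = 0 ∧ v 2 = 0 := by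
  rw [matB_f2_eq h] at hv
  obtain ⟨hl, ha, hla, -⟩ := h
  obtain ⟨h0, hA, hB⟩ := isEigenline_transpose_iff.1 hv
  have hx : -l ^ 2 / a ≠ 0 := by simp [hl, ha]
  generalize -l ^ 2 / a = X at *
  clear hv
  simp at hA hB
  grind

lemma eigenline_f31 {l a : K} (h : (f31 l a).Admissible)
    (hv : IsEigenline (f31 l a).matA (f31 l a).matB c v) :
    v 2 = 0 ∧ (c = l ∧ v 1 = 0 ∨ c = a ∧ v 0 = 0) := by
  obtain ⟨hl, ha, hla, -⟩ := h
  obtain ⟨h0, hA, hB⟩ := isEigenline_iff.1 hv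
  simp at hA hB
  grind

lemma coeigenline_f31 {l a : K} (h : (f31 l a).Admissible)
    (hv : IsEigenline (f31 l a).matAᵀ (f31 l a).matBᵀ c v) : c = a ∧ v 0 = 0 ∧ v 1 = 0 := by
  obtain ⟨hl, ha, hla, -⟩ := h
  obtain ⟨h0, hA, hB⟩ := isEigenline_transpose_iff.1 hv
  simp at hA hB
  grind

lemma eigenline_f32 {l a : K} (h : (f32 l a).Admissible)
    (hv : IsEigenline (f32 l a).matA (f32 l a).matB c v) : c = l ∧ v 1 = 0 ∧ v 2 = 0 := by
  obtain ⟨hl, ha, hla, -⟩ := h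
  obtain ⟨h0, hA, hB⟩ := isEigenline_iff.1 hv
  have hl2 := pow_ne_zero 2 hl
  generalize (l + a) / l ^ 2 = X at *
  generalize l ^ 2 = L at *
  simp at hA hB
  grind

lemma coeigenline_f32 {l a : K} (h : (f32 l a).Admissible)
    (hv : IsEigenline (f32 l a).matAᵀ (f32 l a).matBᵀ c v) : False := by
  obtain ⟨hl, ha, hla, -⟩ := h
  obtain ⟨h0, hA, hB⟩ := isEigenline_transpose_iff.1 hv
  have hl2 := pow_ne_zero 2 hl
  generalize (l + a) / l ^ 2 = X at *
  generalize l ^ 2 = L at *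
  simp at hA hB
  grind

lemma eigenline_f41 {l a β : K} (h : (f41 l a β).Admissible)
    (hv : IsEigenline (f41 l a β).matA (f41 l a β).matB c v) : c = l ∧ v 1 = 0 ∧ v 2 = 0 := by
  obtain ⟨hl, ha, hla, -⟩ := h
  obtain ⟨h0, hA, hB⟩ := isEigenline_iff.1 hv
  generalize 1 + l * β / a ^ 2 = X at *
  simp at hA hB
  grind

lemma coeigenline_f41 {l a β : K} (h : (f41 l a β).Admissible)
    (hv : IsEigenline (f41 l a β).matAᵀ (f41 l a β).matBᵀ c v) :
    v 0 = 0 ∧ (c = l ∧ v 2 = 0 ∨ c = a ∧ v 1 = 0 ∧ β = 0) := by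
  obtain ⟨hl, ha, hla, -⟩ := h
  obtain ⟨h0, hA, hB⟩ := isEigenline_transpose_iff.1 hv
  generalize 1 + l * β / a ^ 2 = X at *
  simp at hA hB
  grind

lemma eigenline_f42 {l a : K} (h : (f42 l a).Admissible)
    (hv : IsEigenline (f42 l a).matA (f42 l a).matB c v) : c = l ∧ v 1 = 0 ∧ v 2 = 0 := by
  obtain ⟨hl, ha, hla, -⟩ := h
  obtain ⟨h0, hA, hB⟩ := isEigenline_iff.1 hv
  generalize 3 * a ^ 2 / 4 = X at *
  generalize a / 2 = Y at *
  generalize -a / 2 = Z at *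
  simp at hA hB
  grind

lemma coeigenline_f42 [CharZero K] {l a : K} (h : (f42 l a).Admissible)
    (hv : IsEigenline (f42 l a).matAᵀ (f42 l a).matBᵀ c v) : False := by
  obtain ⟨hl, ha, hla, -⟩ := h
  obtain ⟨h0, hA, hB⟩ := isEigenline_transpose_iff.1 hv
  have hX : 3 * a ^ 2 / 4 ≠ 0 := by simp [ha]
  generalize 3 * a ^ 2 / 4 = X at *
  generalize a / 2 = Y at *
  generalize -a / 2 = Z at *
  simp at hA hB
  grind

lemma eigenline_f5 {l : K} (hv : IsEigenline (f5 l).matA (f5 l).matB c v) :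
    c = l ∧ v 1 = 0 ∧ v 2 = 0 := by
  obtain ⟨h0, hA, hB⟩ := isEigenline_iff.1 hv
  simp at hA hB
  grind

lemma coeigenline_f5 {l : K} (hv : IsEigenline (f5 l).matAᵀ (f5 l).matBᵀ c v) :
    c = l ∧ v 0 = 0 ∧ v 1 = 0 := by
  obtain ⟨h0, hA, hB⟩ := isEigenline_transpose_iff.1 hv
  simp at hA hB
  grind

/-- No listed pair splits off a line. Outside `f14` the coordinates of the common eigenvectors and
of the common left eigenvectors have disjoint supports. -/
theorem not_splits [CharZero K] {p : B3Form K} (h : p.Admissible) : ¬ Splits p.matA p.matB := by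
  rcases p with ⟨l, a, b⟩ | ⟨l, a, b⟩ | ⟨l, a, b⟩ | ⟨l, a, b⟩ | ⟨l, a⟩ | ⟨l, a⟩ | ⟨l, a⟩ |
    ⟨l, a, β⟩ | ⟨l, a⟩ | ⟨l⟩
  case f14 => exact not_splits_f14 h
  all_goals
    rintro ⟨c, v, w, hv, hw, hvw⟩
    apply hvw
    simp only [dotProduct, Fin.sum_univ_three]
  · have := eigenline_f11 h hv
    have := coeigenline_f11 h hw
    simp [*]
  · have h1 := eigenline_f12 h hv
    have h2 := coeigenline_f12 h hw
    simp [h1, h2]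
  · have h1 := eigenline_f13 h hv
    have h2 := coeigenline_f13 h hw
    simp [h1, h2]
  · have h1 := eigenline_f2 h hv
    have h2 := coeigenline_f2 h hw
    simp [h1, h2]
  · have h1 := eigenline_f31 h hv
    have h2 := coeigenline_f31 h hw
    simp [h1, h2]
  · exact (coeigenline_f32 h hw).elim
  · have h1 := eigenline_f41 h hv
    have h2 := coeigenline_f41 h hw
    simp [h1, h2]
  · exact (coeigenline_f42 h hw).elim
  · have h1 := eigenline_f5 hv
    have h2 := coeigenline_f5 hw
    simp [h1, h2]

end B3Form

end Families

/-! ### The listed pairs satisfy the braid relation -/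

section Families

variable {K : Type*} [Field K]

namespace B3Form

/-- The top left entry of both matrices, by which they act on the first coordinate line. -/
def lam : B3Form K → K
  | f11 l _ _ | f12 l _ _ | f13 l _ _ | f14 l _ _ | f2 l _ | f31 l _ | f32 l _ | f41 l _ _
  | f42 l _ | f5 l => l

lemma det_matA_ne_zero {p : B3Form K} (h : p.Admissible) : p.matA.det ≠ 0 := by
  cases p <;> simp [Admissible, det_fin_three, matA] at h ⊢ <;> tauto

lemma isEigenline_single {p : B3Form K} : IsEigenline p.matA p.matB p.lam ![1, 0, 0] := by
  cases p <;> exact isEigenline_iff.2 (by simp [lam])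

variable [CharZero K]

theorem braid {p : B3Form K} (h : p.Admissible) :
    p.matA * p.matB * p.matA = p.matB * p.matA * p.matB := by
  rcases p with ⟨l, a, b⟩ | ⟨l, a, b⟩ | ⟨l, a, b⟩ | ⟨l, a, b⟩ | ⟨l, a⟩ | ⟨l, a⟩ | ⟨l, a⟩ |
    ⟨l, a, β⟩ | ⟨l, a⟩ | ⟨l⟩
  · obtain ⟨hl, ha, hb, hla, hlb, hab, h⟩ := h
    obtain ⟨h1, h2⟩ := (exists_six_pair_iff hl).1 h
    have h3 : b ^ 2 - b * l + l ^ 2 = 0 := by grind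
    simp only [matA, matB, mul_fin_three, matrix_three_eq_iff]
    clear * - h1 h3
    refine ⟨⟨?_, ?_, ?_⟩, ⟨?_, ?_, ?_⟩, ?_, ?_, ?_⟩ <;> grind
  · obtain ⟨hl, ha, hb, hla, hlb, hab, h⟩ := h
    obtain ⟨h1, h2⟩ := (exists_six_pair_iff hb).1 h
    have h3 : a ^ 2 - a * b + b ^ 2 = 0 := by grind
    simp only [matA, matB, mul_fin_three, matrix_three_eq_iff]
    clear * - h1 h3
    refine ⟨⟨?_, ?_, ?_⟩, ⟨?_, ?_, ?_⟩, ?_, ?_, ?_⟩ <;> grind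
  · obtain ⟨hl, ha, hb, hla, hlb, hab, h⟩ := h
    obtain ⟨h1, h2⟩ := (exists_six_pair_iff ha).1 h
    simp only [matA, matB, mul_fin_three, matrix_three_eq_iff]
    clear * - h1 h2
    refine ⟨⟨?_, ?_, ?_⟩, ⟨?_, ?_, ?_⟩, ?_, ?_, ?_⟩ <;> grind
  · rw [matB_f14_eq h]
    obtain ⟨hl, ha, hb, hla, hlb, hab, h3⟩ := h
    rw [eq_div_iff ha] at h3
    have hd : a - b ≠ 0 := sub_ne_zero.2 hab
    have e1 : b ^ 2 / (b - a) * (a - b) = -b ^ 2 := by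
      have hd' : b - a ≠ 0 := sub_ne_zero.2 hab.symm
      field_simp
      ring
    have e2 : a ^ 2 / (a - b) * (a - b) = a ^ 2 := by
      field_simp
    have e3 : a ^ 2 * (l + b - a) / (l * (a - b)) * (l * (a - b)) = a ^ 2 * (l + b - a) := by
      field_simp
    have e4 : - (a * b * (a ^ 2 - a * b + b ^ 2)) / (a - b) ^ 2 * (a - b) ^ 2 =
        - (a * b * (a ^ 2 - a * b + b ^ 2)) := by
      field_simp
    generalize a ^ 2 * (l + b - a) / (l * (a - b)) = Y at *
    generalize b ^ 2 / (b - a) = Z at *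
    generalize a ^ 2 / (a - b) = W at *
    generalize - (a * b * (a ^ 2 - a * b + b ^ 2)) / (a - b) ^ 2 = X at *
    have hl2 : l ^ 2 = -(a * b) := by linear_combination h3
    -- clearing denominators leaves polynomial relations between the entries
    have f1 : W = a + b - Z := mul_right_cancel₀ hd (by linear_combination e1 + e2)
    have f2 : X = Z * W - a * b := by
      apply mul_right_cancel₀ (pow_ne_zero 2 hd)
      linear_combination e4 - W * (a - b) * e1 + b ^ 2 * e2
    have f3 : Y * b = l * a + a * b - a * Z := by
      apply mul_right_cancel₀ (mul_ne_zero hl hd)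
      linear_combination b * e3 + a * l * e1 - a * (a - b) * hl2
    have f4 : Y * (l * b + a * b - b * W) = a * X := by
      apply mul_left_cancel₀ hb
      linear_combination (l * b + a * b - b * W) * f3 + a * b * hl2 - a * b * f2 -
        a * b * (l + a) * f1 + a * b * e2
    simp only [matA, mul_fin_three, matrix_three_eq_iff]
    clear * - hl2 f1 f2 f3 f4 e1
    refine ⟨⟨?_, ?_, ?_⟩, ⟨?_, ?_, ?_⟩, ?_, ?_, ?_⟩ <;> grind
  · rw [matB_f2_eq h]
    obtain ⟨hl, ha, hla, h⟩ := h
    have h1 := (exists_six_iff ha).1 h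
    have e : -l ^ 2 / a * a = - l ^ 2 := by field_simp
    generalize -l ^ 2 / a = X at *
    simp only [matA, mul_fin_three, matrix_three_eq_iff]
    clear * - h1 e
    refine ⟨⟨?_, ?_, ?_⟩, ⟨?_, ?_, ?_⟩, ?_, ?_, ?_⟩ <;> grind
  · obtain ⟨hl, ha, hla, h⟩ := h
    have h1 := (exists_six_iff ha).1 h
    simp only [matA, matB, mul_fin_three, matrix_three_eq_iff]
    clear * - h1
    refine ⟨⟨?_, ?_, ?_⟩, ⟨?_, ?_, ?_⟩, ?_, ?_, ?_⟩ <;> grind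
  · obtain ⟨hl, ha, hla, h⟩ := h
    have h1 := (exists_four_iff hl).1 h
    have e : (l + a) / l ^ 2 * l ^ 2 = l + a := by field_simp
    simp only [matA, matB]
    generalize (l + a) / l ^ 2 = X at *
    simp only [mul_fin_three, matrix_three_eq_iff]
    clear * - h1 e
    refine ⟨⟨?_, ?_, ?_⟩, ⟨?_, ?_, ?_⟩, ?_, ?_, ?_⟩ <;> grind
  · obtain ⟨hl, ha, hla, h⟩ := h
    have h1 := (exists_six_iff ha).1 h
    have e : (l * β / a ^ 2) * a ^ 2 = l * β := by field_simp
    simp only [matA, matB]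
    generalize l * β / a ^ 2 = X at *
    simp only [mul_fin_three, matrix_three_eq_iff]
    clear * - h1 e
    refine ⟨⟨?_, ?_, ?_⟩, ⟨?_, ?_, ?_⟩, ?_, ?_, ?_⟩ <;> grind
  · obtain ⟨hl, ha, hla, rfl⟩ := h
    simp only [matA, matB, mul_fin_three, matrix_three_eq_iff]
    refine ⟨⟨?_, ?_, ?_⟩, ⟨?_, ?_, ?_⟩, ?_, ?_, ?_⟩ <;> ring
  · rfl

theorem det_matB {p : B3Form K} (h : p.Admissible) : p.matB.det = p.matA.det := by
  rcases p with ⟨l, a, b⟩ | ⟨l, a, b⟩ | ⟨l, a, b⟩ | ⟨l, a, b⟩ | ⟨l, a⟩ | ⟨l, a⟩ | ⟨l, a⟩ |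
    ⟨l, a, β⟩ | ⟨l, a⟩ | ⟨l⟩
  case f14 =>
    rw [matB_f14_eq h]
    obtain ⟨hl, ha, hb, hla, hlb, hab, h3⟩ := h
    have hd : a - b ≠ 0 := sub_ne_zero.2 hab
    have hd' : b - a ≠ 0 := sub_ne_zero.2 hab.symm
    simp [det_fin_three, matA]
    field_simp
    ring
  case f2 =>
    rw [matB_f2_eq h]
    simp [det_fin_three, matA]
  case f42 =>
    obtain ⟨hl, ha, hla, rfl⟩ := h
    simp [det_fin_three, matA, matB]
    ring
  all_goals simp [det_fin_three, matA, matB]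

/-! ### The invariants of the listed pairs -/

/-- The scalars on the invariant lines of a listed pair; see `B3Form.socle_eq`. -/
def socleSet : B3Form K → Set K
  | f11 l _ _ | f13 l _ _ | f14 l _ _ | f2 l _ | f32 l _ | f41 l _ _ | f42 l _ | f5 l => {l}
  | f12 l a _ | f31 l a => {l, a}

/-- The scalars on the one-dimensional quotients of a listed pair; see `B3Form.cosocle_eq`. -/
def cosocleSet : B3Form K → Set K
  | f11 _ a b => {a, b}
  | f12 _ _ b | f13 _ _ b => {b}
  | f14 _ _ _ | f32 _ _ | f42 _ _ => ∅
  | f2 l _ | f5 l => {l}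
  | f31 _ a => {a}
  | f41 l a β => {c | c = l ∨ c = a ∧ β = 0}

theorem socle_eq {p : B3Form K} (h : p.Admissible) (h' : p.NoOverlap) :
    socle p.matA p.matB = p.socleSet := by
  ext c
  constructor
  · rintro ⟨v, hv⟩
    cases p with
    | f11 => exact (eigenline_f11 h hv).1
    | f12 => exact (eigenline_f12 h hv).2.imp And.left And.left
    | f13 => exact (eigenline_f13 h hv).1
    | f14 => exact (eigenline_f14 h h' hv).1
    | f2 => exact (eigenline_f2 h hv).1
    | f31 => exact (eigenline_f31 h hv).2.imp And.left And.left
    | f32 => exact (eigenline_f32 h hv).1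
    | f41 => exact (eigenline_f41 h hv).1
    | f42 => exact (eigenline_f42 h hv).1
    | f5 => exact (eigenline_f5 hv).1
  · intro hc
    cases p with
    | f12 | f31 =>
      obtain rfl | rfl := hc
      · exact ⟨_, isEigenline_single⟩
      · exact ⟨![0, 1, 0], isEigenline_iff.2 (by simp)⟩
    | _ =>
      obtain rfl := hc
      exact ⟨_, isEigenline_single⟩

theorem cosocle_eq {p : B3Form K} (h : p.Admissible) (h' : p.NoOverlap) :
    socle p.matAᵀ p.matBᵀ = p.cosocleSet := by
  ext c
  constructor
  · rintro ⟨v, hv⟩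
    cases p with
    | f11 => exact (coeigenline_f11 h hv).2.imp And.left And.left
    | f12 => exact (coeigenline_f12 h hv).1
    | f13 => exact (coeigenline_f13 h hv).1
    | f14 => exact coeigenline_f14 h h' hv
    | f2 => exact (coeigenline_f2 h hv).1
    | f31 => exact (coeigenline_f31 h hv).1
    | f32 => exact coeigenline_f32 h hv
    | f41 => exact (coeigenline_f41 h hv).2.imp And.left fun h => ⟨h.1, h.2.2⟩
    | f42 => exact coeigenline_f42 h hv
    | f5 => exact (coeigenline_f5 hv).1
  · intro hc
    cases p with
    | f14 | f32 | f42 => exact hc.elim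
    | f11 =>
      obtain rfl | rfl := hc
      · exact ⟨![0, 1, 0], isEigenline_transpose_iff.2 (by simp)⟩
      · exact ⟨![0, 0, 1], isEigenline_transpose_iff.2 (by simp)⟩
    | f41 =>
      obtain rfl | ⟨rfl, rfl⟩ := hc
      · exact ⟨![0, 1, 0], isEigenline_transpose_iff.2 (by simp)⟩
      · exact ⟨![0, 0, 1], isEigenline_transpose_iff.2 (by simp)⟩
    | f2 =>
      obtain rfl := hc
      rw [matB_f2_eq h]
      exact ⟨![0, 1, 0], isEigenline_transpose_iff.2 (by simp)⟩
    | _ =>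
      obtain rfl := hc
      exact ⟨![0, 0, 1], isEigenline_transpose_iff.2 (by simp)⟩

end B3Form

end Families

/-! ### Inequivalence -/

section Families

variable {K : Type*} [Field K]

lemma PairEquiv.socle_eq {A B A' B' : Matrix (Fin 3) (Fin 3) K} (h : PairEquiv A B A' B') :
    socle A B = socle A' B' :=
  Set.ext fun c => h.exists_eigenline_iff c

lemma setOf_eq_or_eq {α : Type*} (a b : α) : {c | c = a ∨ c = b} = {a, b} := rfl

lemma singleton_eq_pair_iff {α : Type*} {a b c : α} : ({a} : Set α) = {b, c} ↔ a = b ∧ a = c := by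
  rw [eq_comm, Set.eq_singleton_iff_unique_mem]
  simp
  grind

lemma pair_eq_singleton_iff {α : Type*} {a b c : α} : ({b, c} : Set α) = {a} ↔ a = b ∧ a = c := by
  rw [eq_comm, singleton_eq_pair_iff]

namespace B3Form

/-- The first matrix is diagonalizable in the family `f2` but not in `f41`. -/
lemma not_pairEquiv_f2_f41 {l a l' a' β : K} (hl : (f2 l a).Admissible)
    (h : PairEquiv (f2 l a).matA (f2 l a).matB (f41 l' a' β).matA (f41 l' a' β).matB)
    (e1 : l = l') (e2 : a = a') : False := by
  subst e1 e2
  obtain ⟨M, hM, hA, -⟩ := h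
  apply hM
  rw [eta_fin_three M] at hA
  simp only [matA, mul_fin_three, matrix_three_eq_iff] at hA
  obtain ⟨⟨-, h1, -⟩, ⟨-, h2, -⟩, h3, -⟩ := hA
  have h4 : M 0 0 = 0 := by linear_combination -h1
  have h5 : M 1 0 = 0 := by linear_combination -h2
  have h6 : M 2 0 = 0 := mul_left_cancel₀ (sub_ne_zero.2 hl.2.2.1) (by linear_combination -h3)
  rw [det_fin_three, h4, h5, h6]
  ring

/-- A matrix conjugating one pair to the other commutes with `A`, so it preserves the generalized
eigenspaces, and the entry `1` of `B` makes it a multiple of the identity up to its `(1, 2)` entry.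
-/
lemma beta_eq_of_pairEquiv {l a β β' : K} (hl : (f41 l a β).Admissible)
    (h : PairEquiv (f41 l a β).matA (f41 l a β).matB (f41 l a β').matA (f41 l a β').matB) :
    β = β' := by
  obtain ⟨M, hM, hA, hB⟩ := h
  have hd := sub_ne_zero.2 hl.2.2.1
  rw [eta_fin_three M] at hA hB
  simp only [matA, matB, mul_fin_three, matrix_three_eq_iff] at hA hB
  obtain ⟨⟨a1, a2, a3⟩, ⟨a4, a5, a6⟩, a7, a8, a9⟩ := hA
  obtain ⟨⟨b1, b2, b3⟩, ⟨b4, b5, b6⟩, b7, b8, b9⟩ := hB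
  have h10 : M 1 0 = 0 := by linear_combination a1
  have h20 : M 2 0 = 0 := mul_left_cancel₀ hd (by linear_combination -a7)
  have h12 : M 1 2 = 0 := mul_left_cancel₀ hd (by linear_combination a6)
  have h02 : M 0 2 = 0 := mul_left_cancel₀ hd (by linear_combination a3 - h12)
  have h21 : M 2 1 = 0 := mul_left_cancel₀ hd (by linear_combination -a8 - h20)
  have h11 : M 0 0 = M 1 1 := by linear_combination -a2
  have h22 : M 2 2 = M 1 1 := by
    rw [h02, h12] at b3
    linear_combination b3 + h11
  have h0 : M 1 1 ≠ 0 := by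
    intro h0
    apply hM
    rw [det_fin_three, h10, h20, h12, h02, h21, h11, h22, h0]
    ring
  apply mul_left_cancel₀ h0
  rw [h20, h21, h22] at b8
  linear_combination b8

/-- The consequences of admissibility that are polynomial in the eigenvalues and suffice to tell the
families apart. -/
def EigenvalueRelations : B3Form K → Prop
  | f11 l a b | f12 l a b | f13 l a b => l ≠ a ∧ l ≠ b ∧ a ≠ b
  | f14 l a b => l ≠ a ∧ l ≠ b ∧ a ≠ b ∧ b * a = -l ^ 2
  | f2 l a | f31 l a | f41 l a _ => l ≠ a
  | f32 l a => l ≠ a ∧ a ^ 2 = -l ^ 2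
  | f42 l a => l ≠ 0 ∧ l = -a
  | f5 _ => True

variable [CharZero K]

lemma Admissible.eigenvalueRelations {p : B3Form K} (h : p.Admissible) :
    p.EigenvalueRelations := by
  cases p with
  | f14 l a b => exact ⟨h.2.2.2.1, h.2.2.2.2.1, h.2.2.2.2.2.1, (eq_div_iff h.2.1).1 h.2.2.2.2.2.2⟩
  | f32 l a => exact ⟨h.2.2.1, (exists_four_iff h.1).1 h.2.2.2⟩
  | _ => simp [Admissible, EigenvalueRelations] at h ⊢ <;> tauto

/-- The invariants determine the family and its parameters, up to two points that need the
conjugating matrix itself: telling `f2` from `f41`, and finding the parameter `β`. -/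
theorem sameUpToOrder_of_pairEquiv {p q : B3Form K} (hp : p.Admissible) (hp' : p.NoOverlap)
    (hq : q.Admissible) (hq' : q.NoOverlap) (h : PairEquiv p.matA p.matB q.matA q.matB) :
    SameUpToOrder p q := by
  have hS : p.socleSet = q.socleSet := by
    rw [← socle_eq hp hp', ← socle_eq hq hq', h.socle_eq]
  have hC : p.cosocleSet = q.cosocleSet := by
    rw [← cosocle_eq hp hp', ← cosocle_eq hq hq', h.transpose.socle_eq]
  have hT := h.trace_left
  have hpn := hp.eigenvalueRelations
  have hqn := hq.eigenvalueRelations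
  rcases p with ⟨l, a, b⟩ | ⟨l, a, b⟩ | ⟨l, a, b⟩ | ⟨l, a, b⟩ | ⟨l, a⟩ | ⟨l, a⟩ | ⟨l, a⟩ |
    ⟨l, a, β⟩ | ⟨l, a⟩ | ⟨l⟩
  case' f41 => rcases eq_or_ne β 0 with rfl | hβ
  all_goals
    rcases q with ⟨l', a', b'⟩ | ⟨l', a', b'⟩ | ⟨l', a', b'⟩ | ⟨l', a', b'⟩ | ⟨l', a'⟩ | ⟨l', a'⟩ |
      ⟨l', a'⟩ | ⟨l', a', β'⟩ | ⟨l', a'⟩ | ⟨l'⟩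
    case' f41 => rcases eq_or_ne β' 0 with rfl | hβ'
  all_goals
    simp only [*, cosocleSet, socleSet] at hS hC
    simp [setOf_eq_or_eq, singleton_eq_pair_iff, pair_eq_singleton_iff, Set.pair_eq_pair_iff,
      (Set.insert_nonempty _ _).ne_empty.symm, (Set.singleton_ne_empty _).symm] at hS hC
  all_goals
    simp only [EigenvalueRelations] at hpn hqn
    simp only [matA, trace_fin_three, cons_val', cons_val, of_apply] at hT
  -- pairs of different families have incompatible invariants
  all_goals try (exfalso; clear h hp hp' hq hq'; grind)
  case f11.f11 =>
    obtain rfl := hS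
    obtain ⟨rfl, rfl⟩ | ⟨rfl, rfl⟩ := hC
    · exact .refl _
    · exact .swap11 _ _ _
  case f12.f12 =>
    obtain rfl := hC
    obtain ⟨rfl, rfl⟩ | ⟨rfl, rfl⟩ := hS
    · exact .refl _
    · exact .swap12 _ _ _
  case f13.f13 =>
    obtain rfl := hS
    obtain rfl := hC
    obtain rfl : a = a' := by linear_combination -hT
    exact .refl _
  case f14.f14 =>
    obtain rfl := hS
    have h0 : (a' - a) * (a' - b) = 0 := by linear_combination a' * hT - hqn.2.2.2 + hpn.2.2.2
    obtain h0 | h0 := mul_eq_zero.1 h0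
    · obtain rfl : a' = a := sub_eq_zero.1 h0
      obtain rfl : b = b' := by linear_combination -hT
      exact .refl _
    · obtain rfl : a' = b := sub_eq_zero.1 h0
      obtain rfl : a = b' := by linear_combination -hT
      exact .swap14 _ _ _
  case f2.f2 =>
    obtain rfl := hS
    obtain rfl : a = a' := by linear_combination -hT
    exact .refl _
  case f2.f41.inr =>
    obtain rfl := hS
    exact (not_pairEquiv_f2_f41 hp h rfl (by linear_combination -hT)).elim
  case f41.inr.f2 =>
    obtain rfl := hS
    exact (not_pairEquiv_f2_f41 hq h.symm rfl (by linear_combination hT)).elim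
  case f31.f31 =>
    obtain rfl := hC
    obtain rfl : l = l' := by linear_combination -hT
    exact .refl _
  case f32.f32 =>
    obtain rfl := hS
    obtain rfl : a = a' := by linear_combination -hT / 2
    exact .refl _
  case f41.inl.f41.inl =>
    obtain rfl := hS
    obtain rfl : a = a' := by linear_combination -hT
    exact .refl _
  case f41.inr.f41.inr =>
    obtain rfl := hS
    obtain rfl : a = a' := by linear_combination -hT
    obtain rfl := beta_eq_of_pairEquiv hp h
    exact .refl _
  case f42.f42 =>
    obtain rfl := hS
    obtain rfl : a = a' := by linear_combination -hT
    exact .refl _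
  case f5.f5 =>
    obtain rfl := hS
    exact .refl _

/-- The converse; exchanging `l₂` and `l₃` in `f14` takes the transposition of the last two basis
vectors followed by a diagonal rescaling. -/
theorem pairEquiv_of_sameUpToOrder {p q : B3Form K} (hp : p.Admissible) (hp' : p.NoOverlap)
    (hq : q.Admissible) (h : SameUpToOrder p q) :
    PairEquiv p.matA p.matB q.matA q.matB := by
  obtain _ | ⟨l, a, b⟩ | ⟨l, a, b⟩ | ⟨l, a, b⟩ := h
  · exact PairEquiv.refl _ _
  · exact pairEquiv_swap
  · exact pairEquiv_of_entries 0 1 0 1 0 0 0 0 1 (by simp) (by simp) (by simp)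
  · rw [matB_f14_eq hp, matB_f14_eq hq]
    have hn := f14_ne_zero hp hp'
    obtain ⟨hl, ha, hb, hla, hlb, hab, h3⟩ := hp
    rw [eq_div_iff ha] at h3
    have hd : a - b ≠ 0 := sub_ne_zero.2 hab
    have hd' : b - a ≠ 0 := sub_ne_zero.2 hab.symm
    have key : a ^ 2 * (l + b - a) / (l * (a - b)) * (b ^ 2 * (l + a - b) / (l * (b - a))) =
        -(a * b * (a ^ 2 - a * b + b ^ 2)) / (a - b) ^ 2 := by
      field_simp
      linear_combination -(a - b) ^ 3 * h3
    have hX : -(a * b * (a ^ 2 - a * b + b ^ 2)) / (a - b) ^ 2 ≠ 0 := by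
      simp [ha, hb, hn, hd]
    have hX' : -(b * a * (b ^ 2 - b * a + a ^ 2)) / (b - a) ^ 2 =
        -(a * b * (a ^ 2 - a * b + b ^ 2)) / (a - b) ^ 2 := by
      field_simp
      ring
    rw [hX']
    generalize -(a * b * (a ^ 2 - a * b + b ^ 2)) / (a - b) ^ 2 = X at *
    generalize a ^ 2 * (l + b - a) / (l * (a - b)) = Y at *
    generalize b ^ 2 * (l + a - b) / (l * (b - a)) = Y' at *
    have hY : Y ≠ 0 := by
      rintro rfl
      exact hX (by rw [← key, zero_mul])
    refine pairEquiv_of_entries Y 0 0 0 0 X 0 1 0 (by simp [hY, hX]) (by simp [mul_comm]) ?_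
    simp [mul_comm]
    rw [← key, mul_comm]

end B3Form

end Families

/-! ### Representations of the braid group and its generators -/

section Relations

variable {K V W : Type*} [Field K] [AddCommGroup V] [Module K V] [AddCommGroup W] [Module K W]

namespace BraidGroup3

theorem braid_relation : σ₁ * σ₂ * σ₁ = σ₂ * σ₁ * σ₂ := by
  have h : (PresentedGroup.mk
      ({FreeGroup.of 0 * FreeGroup.of 1 * FreeGroup.of 0 *
        (FreeGroup.of 1 * FreeGroup.of 0 * FreeGroup.of 1)⁻¹} : Set (FreeGroup (Fin 2))))
      (FreeGroup.of 0 * FreeGroup.of 1 * FreeGroup.of 0 *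
        (FreeGroup.of 1 * FreeGroup.of 0 * FreeGroup.of 1)⁻¹) = 1 :=
    PresentedGroup.one_of_mem (Set.mem_singleton _)
  rw [map_mul, map_inv, mul_inv_eq_one] at h
  simp only [map_mul] at h
  exact h

theorem mem_of_generators (H : Subgroup BraidGroup3) (h₁ : σ₁ ∈ H) (h₂ : σ₂ ∈ H)
    (g : BraidGroup3) : g ∈ H :=
  PresentedGroup.generated_by _ H (Fin.forall_fin_two.2 ⟨h₁, h₂⟩) g

variable {ρ : Representation K BraidGroup3 V} {τ : Representation K BraidGroup3 W}

theorem rep_braid (ρ : Representation K BraidGroup3 V) :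
    ρ σ₁ * ρ σ₂ * ρ σ₁ = ρ σ₂ * ρ σ₁ * ρ σ₂ := by
  simp only [← map_mul, braid_relation]

/-- A linear isomorphism that intertwines the two generators is an equivalence of
representations. -/
theorem nonempty_equiv_of_generators (e : V ≃ₗ[K] W) (h₁ : ∀ v, e (ρ σ₁ v) = τ σ₁ (e v))
    (h₂ : ∀ v, e (ρ σ₂ v) = τ σ₂ (e v)) : Nonempty (ρ.Equiv τ) := by
  let H : Subgroup BraidGroup3 :=
    { carrier := {g | ∀ v, e (ρ g v) = τ g (e v)}
      one_mem' := by simp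
      mul_mem' := by
        intro g g' hg hg' v
        simp [hg _, hg' _]
      inv_mem' := by
        intro g hg v
        have := hg (ρ g⁻¹ v)
        rw [Representation.self_inv_apply] at this
        rw [this, Representation.inv_self_apply] }
  exact ⟨Representation.Equiv.mk e fun g ↦ LinearMap.ext (mem_of_generators H h₁ h₂ g)⟩

/-- A finite-dimensional subspace stable under both generators is stable under the group: an
injective map of a finite-dimensional space is onto, so inverses preserve the subspace too. -/
theorem exists_subrepresentation [FiniteDimensional K V] (U : Submodule K V)
    (h₁ : ∀ v ∈ U, ρ σ₁ v ∈ U) (h₂ : ∀ v ∈ U, ρ σ₂ v ∈ U) :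
    ∃ S : Subrepresentation ρ, S.toSubmodule = U := by
  let H : Subgroup BraidGroup3 :=
    { carrier := {g | ∀ v ∈ U, ρ g v ∈ U}
      one_mem' := by simp
      mul_mem' := by
        intro g g' hg hg' v hv
        simpa using hg _ (hg' _ hv)
      inv_mem' := by
        intro g hg v hv
        have hinj : Function.Injective (ρ g) := fun x y hxy ↦ by
          simpa using congrArg (ρ g⁻¹) hxy
        have hmap : U.map (ρ g) = U := by
          refine Submodule.eq_of_le_of_finrank_eq (Submodule.map_le_iff_le_comap.2 hg) ?_
          exact (Submodule.equivMapOfInjective _ hinj U).finrank_eq.symm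
        obtain ⟨u, hu, rfl⟩ := hmap.ge hv
        simpa using hu }
  exact ⟨⟨U, fun g v hv ↦ mem_of_generators H h₁ h₂ g v hv⟩, rfl⟩

end BraidGroup3

end Relations

/-! ### Representations in coordinates -/

section MatrixRepresentation

variable {K V : Type*} [Field K] [AddCommGroup V] [Module K V]

open BraidGroup3

/-- In the coordinates `e`, the generators act by the matrices `A` and `B`. -/
structure HasMatrices (ρ : Representation K BraidGroup3 V) (e : V ≃ₗ[K] (Fin 3 → K))
    (A B : Matrix (Fin 3) (Fin 3) K) : Prop where
  left (v : V) : e (ρ σ₁ v) = A *ᵥ e v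
  right (v : V) : e (ρ σ₂ v) = B *ᵥ e v

theorem exists_hasMatrices (ρ : Representation K BraidGroup3 V) (e : V ≃ₗ[K] (Fin 3 → K)) :
    ∃ A B, HasMatrices ρ e A B :=
  ⟨LinearMap.toMatrix' (e.conj (ρ σ₁)), LinearMap.toMatrix' (e.conj (ρ σ₂)),
    fun v ↦ by simp [LinearMap.toMatrix'_mulVec], fun v ↦ by simp [LinearMap.toMatrix'_mulVec]⟩

theorem B3Form.IsRepOf.hasMatrices {p : B3Form K}
    {τ : Representation K BraidGroup3 (Fin 3 → K)} (h : p.IsRepOf τ) :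
    HasMatrices τ (LinearEquiv.refl K _) p.matA p.matB :=
  ⟨fun v ↦ by simp [h.1], fun v ↦ by simp [h.2]⟩

/-- Invertible matrices that satisfy the braid relation define a representation. -/
theorem exists_rep {A B : Matrix (Fin 3) (Fin 3) K} (hA : A.det ≠ 0) (hB : B.det ≠ 0)
    (h : A * B * A = B * A * B) : ∃ τ : Representation K BraidGroup3 (Fin 3 → K),
      τ σ₁ = Matrix.toLin' A ∧ τ σ₂ = Matrix.toLin' B := by
  let u := A.nonsingInvUnit hA.isUnit
  let v := B.nonsingInvUnit hB.isUnit
  have huv : u * v * u = v * u * v := Units.ext h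
  have hrel : ∀ r ∈ ({FreeGroup.of 0 * FreeGroup.of 1 * FreeGroup.of 0 *
      (FreeGroup.of 1 * FreeGroup.of 0 * FreeGroup.of 1)⁻¹} : Set (FreeGroup (Fin 2))),
      FreeGroup.lift ![u, v] r = 1 := by
    rintro r rfl
    simp only [map_mul, map_inv, FreeGroup.lift_apply_of, Matrix.cons_val_zero, Matrix.cons_val_one]
    rw [huv, mul_inv_cancel]
  refine ⟨(Matrix.toLinAlgEquiv' (R := K) (n := Fin 3)).toMonoidHom.comp
    ((Units.coeHom _).comp (PresentedGroup.toGroup hrel)), ?_, ?_⟩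
  · change Matrix.toLin' (PresentedGroup.toGroup hrel (PresentedGroup.of 0)).val = _
    rw [PresentedGroup.toGroup.of]
    rfl
  · change Matrix.toLin' (PresentedGroup.toGroup hrel (PresentedGroup.of 1)).val = _
    rw [PresentedGroup.toGroup.of]
    rfl

namespace HasMatrices

variable {ρ : Representation K BraidGroup3 V} {e : V ≃ₗ[K] (Fin 3 → K)}
  {A B : Matrix (Fin 3) (Fin 3) K}

theorem finrank_eq (_ : HasMatrices ρ e A B) : Module.finrank K V = 3 := by
  simpa using e.finrank_eq

theorem finiteDimensional (_ : HasMatrices ρ e A B) : FiniteDimensional K V :=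
  e.symm.finiteDimensional

theorem det_left_ne_zero (h : HasMatrices ρ e A B) : A.det ≠ 0 := by
  intro h0
  obtain ⟨v, hv, hAv⟩ := Matrix.exists_mulVec_eq_zero_iff.2 h0
  have := h.left (e.symm v)
  rw [e.apply_symm_apply, hAv, e.map_eq_zero_iff] at this
  have h1 : ρ σ₁⁻¹ (ρ σ₁ (e.symm v)) = 0 := by rw [this, map_zero]
  rw [Representation.inv_self_apply, e.symm.map_eq_zero_iff] at h1
  exact hv h1

theorem det_right_ne_zero (h : HasMatrices ρ e A B) : B.det ≠ 0 := by
  intro h0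
  obtain ⟨v, hv, hAv⟩ := Matrix.exists_mulVec_eq_zero_iff.2 h0
  have := h.right (e.symm v)
  rw [e.apply_symm_apply, hAv, e.map_eq_zero_iff] at this
  have h1 : ρ σ₂⁻¹ (ρ σ₂ (e.symm v)) = 0 := by rw [this, map_zero]
  rw [Representation.inv_self_apply, e.symm.map_eq_zero_iff] at h1
  exact hv h1

theorem braid (h : HasMatrices ρ e A B) : A * B * A = B * A * B := by
  refine Matrix.ext_of_mulVec_single fun i ↦ ?_
  obtain ⟨v, hv⟩ := e.surjective (Pi.single i 1)
  rw [← hv]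
  have := congrArg e (LinearMap.congr_fun (rep_braid ρ) v)
  simpa [h.left, h.right, Matrix.mul_assoc] using this

/-- By the braid relation the generators act by the same scalar on an invariant line. -/
theorem isEigenline (h : HasMatrices ρ e A B) {W : Subrepresentation ρ}
    (hW : Module.finrank K W.toSubmodule = 1) :
    ∃ (c : K) (v : V), IsEigenline A B c (e v) ∧ W.toSubmodule = K ∙ v := by
  obtain ⟨⟨v, hvW⟩, hv, hspan⟩ := finrank_eq_one_iff'.1 hW
  obtain ⟨a, ha⟩ := hspan ⟨_, W.apply_mem_toSubmodule σ₁ hvW⟩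
  obtain ⟨b, hb⟩ := hspan ⟨_, W.apply_mem_toSubmodule σ₂ hvW⟩
  have hv : v ≠ 0 := fun h0 ↦ hv (Subtype.ext h0)
  have ha : ρ σ₁ v = a • v := (congrArg Subtype.val ha).symm
  have hb : ρ σ₂ v = b • v := (congrArg Subtype.val hb).symm
  have ha0 : a ≠ 0 := by
    rintro rfl
    have := ρ.inv_self_apply σ₁ v
    rw [ha, zero_smul, map_zero] at this
    exact hv this.symm
  have hb0 : b ≠ 0 := by
    rintro rfl
    have := ρ.inv_self_apply σ₂ v
    rw [hb, zero_smul, map_zero] at this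
    exact hv this.symm
  have hab : a = b := by
    have := LinearMap.congr_fun (rep_braid ρ) v
    simp only [Module.End.mul_apply, ha, hb, map_smul, smul_smul] at this
    have := smul_left_injective K hv this
    have h2 : (a * b) * (a - b) = 0 := by linear_combination this
    simpa [ha0, hb0, sub_eq_zero] using h2
  subst hab
  refine ⟨a, v, ⟨by simpa using hv, by rw [← h.left, ha, map_smul],
    by rw [← h.right, hb, map_smul]⟩, le_antisymm ?_ ?_⟩
  · intro x hx
    obtain ⟨t, ht⟩ := hspan ⟨x, hx⟩
    exact Submodule.mem_span_singleton.2 ⟨t, congrArg Subtype.val ht⟩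
  · simpa using hvW

theorem exists_span_subrepresentation (h : HasMatrices ρ e A B) {c : K} {v : Fin 3 → K}
    (hv : IsEigenline A B c v) :
    ∃ W : Subrepresentation ρ, W.toSubmodule = K ∙ e.symm v := by
  have := h.finiteDimensional
  refine exists_subrepresentation _ ?_ ?_
  · intro x hx
    obtain ⟨t, rfl⟩ := Submodule.mem_span_singleton.1 hx
    refine Submodule.mem_span_singleton.2 ⟨t * c, e.injective ?_⟩
    rw [h.left]
    simp [mulVec_smul, hv.2.1, smul_smul]
  · intro x hx
    obtain ⟨t, rfl⟩ := Submodule.mem_span_singleton.1 hx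
    refine Submodule.mem_span_singleton.2 ⟨t * c, e.injective ?_⟩
    rw [h.right]
    simp [mulVec_smul, hv.2.2, smul_smul]

theorem minInvariantDim_one_iff (h : HasMatrices ρ e A B) :
    MinInvariantDim ρ 1 ↔ ∃ c v, IsEigenline A B c v := by
  have := h.finiteDimensional
  constructor
  · rintro ⟨⟨W, -, hW⟩, -⟩
    obtain ⟨c, v, hv, -⟩ := h.isEigenline hW
    exact ⟨c, _, hv⟩
  · rintro ⟨c, v, hv⟩
    obtain ⟨W, hW⟩ := h.exists_span_subrepresentation hv
    have hv0 : e.symm v ≠ 0 := by simpa using hv.1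
    refine ⟨⟨W, by simpa [hW] using hv.1, by rw [hW]; exact finrank_span_singleton hv0⟩, ?_⟩
    rintro k ⟨U, hU, rfl⟩
    exact Submodule.one_le_finrank_iff.2 hU

theorem not_isIrreducible (h : HasMatrices ρ e A B) {c : K} {v : Fin 3 → K}
    (hv : IsEigenline A B c v) : ¬ ρ.IsIrreducible := by
  intro hirr
  obtain ⟨W, hW⟩ := h.exists_span_subrepresentation hv
  have hv0 : e.symm v ≠ 0 := by simpa using hv.1
  have hfin : Module.finrank K W.toSubmodule = 1 := by
    rw [hW]
    exact finrank_span_singleton hv0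
  rcases hirr.eq_bot_or_eq_top W with rfl | rfl
  · have : Module.finrank K (⊥ : Submodule K V) = 1 := hfin
    simp at this
  · have : Module.finrank K (⊤ : Submodule K V) = 1 := hfin
    simp [h.finrank_eq] at this

/-- The functional `w` of the splitting vanishes on the complement of the line. -/
theorem splits_of_isCompl (h : HasMatrices ρ e A B) {W₁ W₂ : Subrepresentation ρ}
    (hW : IsCompl W₁.toSubmodule W₂.toSubmodule)
    (h1 : Module.finrank K W₁.toSubmodule = 1) : Splits A B := by
  obtain ⟨c, v, hv, hspan⟩ := h.isEigenline h1
  have hv0 : v ≠ 0 := by simpa using hv.1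
  have hvW : v ∉ W₂.toSubmodule := by
    intro hmem
    refine hv0 (Submodule.disjoint_def.1 hW.disjoint v ?_ hmem)
    rw [hspan]
    exact Submodule.mem_span_singleton_self v
  obtain ⟨f, hf, hmap⟩ := Submodule.exists_dual_map_eq_bot_of_notMem hvW inferInstance
  have hf2 : ∀ u ∈ W₂.toSubmodule, f u = 0 := fun u hu ↦ by
    simpa [hmap] using Submodule.mem_map_of_mem (f := f) hu
  -- the functional vanishes on the complement, so every generator scales it by `c`
  have key : ∀ g : BraidGroup3, ρ g v = c • v → ∀ u, f (ρ g u) = c * f u := by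
    intro g hg u
    obtain ⟨x, hx, y, hy, rfl⟩ := Submodule.mem_sup.1
      (hW.sup_eq_top.ge (Submodule.mem_top (x := u)))
    rw [hspan] at hx
    obtain ⟨t, rfl⟩ := Submodule.mem_span_singleton.1 hx
    simp [hg, hf2 y hy, hf2 _ (W₂.apply_mem_toSubmodule g hy)]
    ring
  have hσ₁ : ρ σ₁ v = c • v := e.injective (by rw [h.left, hv.2.1, map_smul])
  have hσ₂ : ρ σ₂ v = c • v := e.injective (by rw [h.right, hv.2.2, map_smul])
  let w : Fin 3 → K := fun i ↦ f (e.symm (Pi.single i 1))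
  have hw : ∀ x, w ⬝ᵥ x = f (e.symm x) := by
    intro x
    have := LinearMap.pi_apply_eq_sum_univ (f ∘ₗ e.symm.toLinearMap) x
    simp only [LinearMap.comp_apply, LinearEquiv.coe_coe] at this
    rw [this]
    refine Finset.sum_congr rfl fun i _ ↦ ?_
    rw [smul_eq_mul, mul_comm]
    have hi : (Pi.single i 1 : Fin 3 → K) = fun j ↦ if i = j then 1 else 0 := by
      ext j
      simp [Pi.single_apply, eq_comm]
    simp only [w, hi]
  refine ⟨c, e v, w, hv, ⟨?_, ?_, ?_⟩, by rw [hw, e.symm_apply_apply]; exact hf⟩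
  · intro h0
    have := hw (e v)
    rw [h0, zero_dotProduct, e.symm_apply_apply] at this
    exact hf this.symm
  · refine dotProduct_eq _ _ fun x ↦ ?_
    obtain ⟨u, rfl⟩ := e.surjective x
    rw [mulVec_transpose, ← dotProduct_mulVec, ← h.left, hw, smul_dotProduct, hw,
      e.symm_apply_apply, e.symm_apply_apply, key _ hσ₁, smul_eq_mul]
  · refine dotProduct_eq _ _ fun x ↦ ?_
    obtain ⟨u, rfl⟩ := e.surjective x
    rw [mulVec_transpose, ← dotProduct_mulVec, ← h.right, hw, smul_dotProduct, hw,
      e.symm_apply_apply, e.symm_apply_apply, key _ hσ₂, smul_eq_mul]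

/-- One of two complementary nonzero subspaces of a three-dimensional space is a line. -/
theorem isIndecomposableRep_iff (h : HasMatrices ρ e A B) :
    IsIndecomposableRep ρ ↔ ¬ Splits A B := by
  have := h.finiteDimensional
  constructor
  · rintro hind ⟨c, v, w, hv, hw, hwv⟩
    obtain ⟨W₁, hW₁⟩ := h.exists_span_subrepresentation hv
    let φ : V →ₗ[K] K := (dotProductBilin K K w) ∘ₗ e.toLinearMap
    have hφ : ∀ u, φ u = w ⬝ᵥ e u := fun u ↦ rfl
    obtain ⟨W₂, hW₂⟩ := exists_subrepresentation (ρ := ρ) (LinearMap.ker φ)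
      (fun u hu ↦ by
        rw [LinearMap.mem_ker, hφ] at hu ⊢
        rw [h.left, dotProduct_mulVec, ← mulVec_transpose, hw.2.1, smul_dotProduct, hu,
          smul_zero])
      (fun u hu ↦ by
        rw [LinearMap.mem_ker, hφ] at hu ⊢
        rw [h.right, dotProduct_mulVec, ← mulVec_transpose, hw.2.2, smul_dotProduct, hu,
          smul_zero])
    have hφv : φ (e.symm v) ≠ 0 := by simpa [hφ] using hwv
    have hc : IsCompl W₁.toSubmodule W₂.toSubmodule := by
      rw [hW₁, hW₂]
      refine ⟨Submodule.disjoint_def.2 ?_, Submodule.codisjoint_iff_exists_add_eq.2 fun u ↦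
        ⟨(φ u / φ (e.symm v)) • e.symm v, u - (φ u / φ (e.symm v)) • e.symm v,
          Submodule.smul_mem _ _ (Submodule.mem_span_singleton_self _), ?_, add_sub_cancel _ _⟩⟩
      · intro x hx hx'
        obtain ⟨t, rfl⟩ := Submodule.mem_span_singleton.1 hx
        rw [LinearMap.mem_ker, map_smul, smul_eq_mul, mul_eq_zero] at hx'
        rw [hx'.resolve_right hφv, zero_smul]
      · rw [LinearMap.mem_ker, map_sub, map_smul, smul_eq_mul, div_mul_cancel₀ _ hφv, sub_self]
    have hv0 : e.symm v ≠ 0 := by simpa using hv.1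
    have h1 : Module.finrank K W₁.toSubmodule = 1 := by
      rw [hW₁]
      exact finrank_span_singleton hv0
    have hsum := Submodule.finrank_add_eq_of_isCompl hc
    rw [h.finrank_eq] at hsum
    rcases hind W₁ W₂ hc with h0 | h0
    · rw [h0, finrank_bot] at h1
      omega
    · rw [h0, h1, finrank_bot] at hsum
      omega
  · intro hs W₁ W₂ hc
    by_contra! hne
    have hsum := Submodule.finrank_add_eq_of_isCompl hc
    rw [h.finrank_eq] at hsum
    have h1 := Submodule.one_le_finrank_iff.2 hne.1
    have h2 := Submodule.one_le_finrank_iff.2 hne.2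
    obtain h1 | h2 : Module.finrank K W₁.toSubmodule = 1 ∨
      Module.finrank K W₂.toSubmodule = 1 := by omega
    · exact hs (h.splits_of_isCompl hc h1)
    · exact hs (h.splits_of_isCompl hc.symm h2)

variable {τ : Representation K BraidGroup3 (Fin 3 → K)} {A' B' : Matrix (Fin 3) (Fin 3) K}

theorem nonempty_equiv (h : HasMatrices ρ e A B)
    (h' : HasMatrices τ (LinearEquiv.refl K _) A' B') (hp : PairEquiv A B A' B') :
    Nonempty (ρ.Equiv τ) := by
  obtain ⟨M, hM, hAM, hBM⟩ := hp.symm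
  let m := Matrix.toLinearEquiv' M (invertibleOfIsUnitDet M hM.isUnit)
  have hm : ∀ x, m x = M *ᵥ x := fun x ↦ rfl
  refine nonempty_equiv_of_generators (e.trans m) (fun v ↦ ?_) (fun v ↦ ?_)
  · have := h'.left (m (e v))
    simp only [LinearEquiv.refl_apply] at this
    simp only [LinearEquiv.trans_apply]
    rw [this, h.left, hm, hm, mulVec_mulVec, mulVec_mulVec, hAM]
  · have := h'.right (m (e v))
    simp only [LinearEquiv.refl_apply] at this
    simp only [LinearEquiv.trans_apply]
    rw [this, h.right, hm, hm, mulVec_mulVec, mulVec_mulVec, hBM]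

theorem pairEquiv (h : HasMatrices ρ e A B)
    (h' : HasMatrices τ (LinearEquiv.refl K _) A' B') (E : ρ.Equiv τ) : PairEquiv A B A' B' := by
  let m : (Fin 3 → K) ≃ₗ[K] (Fin 3 → K) := e.symm.trans E.toLinearEquiv
  have hE : ∀ g v, E (ρ g v) = τ g (E v) := fun g v ↦
    E.toIntertwiningMap.isIntertwining _ _ g v
  have hm : ∀ v, LinearMap.toMatrix' m.toLinearMap *ᵥ e v = E v := fun v ↦ by
    rw [LinearMap.toMatrix'_mulVec]
    simp [m]
  refine PairEquiv.symm ⟨LinearMap.toMatrix' m.toLinearMap, ?_, ?_, ?_⟩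
  · rw [LinearMap.det_toMatrix']
    exact (LinearEquiv.isUnit_det' m).ne_zero
  · refine Matrix.ext_of_mulVec_single fun i ↦ ?_
    obtain ⟨v, hv⟩ := e.surjective (Pi.single i 1)
    rw [← hv, ← mulVec_mulVec, ← mulVec_mulVec, hm, ← h.left, hm, hE]
    exact (h'.left (E v)).symm
  · refine Matrix.ext_of_mulVec_single fun i ↦ ?_
    obtain ⟨v, hv⟩ := e.surjective (Pi.single i 1)
    rw [← hv, ← mulVec_mulVec, ← mulVec_mulVec, hm, ← h.right, hm, hE]
    exact (h'.right (E v)).symm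

end HasMatrices

end MatrixRepresentation

/-! ### The classification -/

section Classification

variable {K : Type*} [Field K]

/-- Conjugation by a matrix whose first column is an eigenvector. -/
theorem mul_single_eq {M N A : Matrix (Fin 3) (Fin 3) K} {c : K} {v : Fin 3 → K}
    (hA : A *ᵥ v = c • v) (hM : M *ᵥ ![1, 0, 0] = v) (hNM : N * M = 1) :
    (N * A * M) *ᵥ ![1, 0, 0] = ![c, 0, 0] := by
  rw [← mulVec_mulVec, hM, ← mulVec_mulVec, hA, ← hM, mulVec_smul, mulVec_mulVec, hNM]
  simp

theorem eq_of_mulVec_eq {A : Matrix (Fin 3) (Fin 3) K} {c : K}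
    (hA : A *ᵥ ![1, 0, 0] = ![c, 0, 0]) :
    A = !![c, A 0 1, A 0 2; 0, A 1 1, A 1 2; 0, A 2 1, A 2 2] := by
  have h0 := congrFun hA 0
  have h1 := congrFun hA 1
  have h2 := congrFun hA 2
  simp [mulVec, dotProduct, Fin.sum_univ_three] at h0 h1 h2
  ext i j
  fin_cases i <;> fin_cases j <;> simp [h0, h1, h2]

theorem exists_first_column {v : Fin 3 → K} (hv : v ≠ 0) :
    ∃ M : Matrix (Fin 3) (Fin 3) K, M.det ≠ 0 ∧ M *ᵥ ![1, 0, 0] = v := by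
  by_cases h0 : v 0 = 0
  · by_cases h1 : v 1 = 0
    · have h2 : v 2 ≠ 0 := fun h2 ↦ hv (by ext i; fin_cases i <;> assumption)
      refine ⟨!![v 0, 1, 0; v 1, 0, 1; v 2, 0, 0], by simp [det_fin_three, h2], ?_⟩
      ext i; fin_cases i <;> simp
    · refine ⟨!![v 0, 1, 0; v 1, 0, 0; v 2, 0, 1], by simp [det_fin_three, h1], ?_⟩
      ext i; fin_cases i <;> simp
  · refine ⟨!![v 0, 0, 0; v 1, 1, 0; v 2, 0, 1], by simp [det_fin_three, h0], ?_⟩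
    ext i; fin_cases i <;> simp [mulVec, dotProduct, Fin.sum_univ_three]

theorem classified_of_eigenline [IsAlgClosed K] [CharZero K] {A B : Matrix (Fin 3) (Fin 3) K}
    (G : IsIndecBraidPair A B) {c : K} {v : Fin 3 → K} (hv : IsEigenline A B c v) :
    Classified A B := by
  obtain ⟨M, hM, hMv⟩ := exists_first_column hv.1
  have h₁ : M⁻¹ * M = 1 := nonsing_inv_mul M hM.isUnit
  have h₂ : M * M⁻¹ = 1 := mul_nonsing_inv M hM.isUnit
  have hp : PairEquiv A B (M⁻¹ * A * M) (M⁻¹ * B * M) :=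
    ⟨M, hM, by simp only [← Matrix.mul_assoc, h₂, Matrix.one_mul],
      by simp only [← Matrix.mul_assoc, h₂, Matrix.one_mul]⟩
  have hA := eq_of_mulVec_eq (mul_single_eq hv.2.1 hMv h₁)
  have hB := eq_of_mulVec_eq (mul_single_eq hv.2.2 hMv h₁)
  rw [hA, hB] at hp
  exact (classified_of_common_eigenvector (G.of_pairEquiv hp)).of_pairEquiv hp

end Classification
theorem mainTheorem2 (K : Type*) [Field K] [IsAlgClosed K] [CharZero K] :
    -- completeness of the list
    (∀ (V : Type*) [AddCommGroup V] [Module K V] (ρ : Representation K BraidGroup3 V),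
      Module.finrank K V = 3 → IsStrictlyIndecomposable ρ → MinInvariantDim ρ 1 →
        ∃ (p : B3Form K) (τ : Representation K BraidGroup3 (Fin 3 → K)),
          p.Admissible ∧ p.NoOverlap ∧ p.IsRepOf τ ∧ Nonempty (ρ.Equiv τ)) ∧
    -- every listed pair defines a representation of the required kind
    (∀ p : B3Form K, p.Admissible →
      ∃ τ : Representation K BraidGroup3 (Fin 3 → K),
        p.IsRepOf τ ∧ IsStrictlyIndecomposable τ ∧ MinInvariantDim τ 1) ∧
    -- the listed representations are pairwise inequivalent
    (∀ (p q : B3Form K) (τ υ : Representation K BraidGroup3 (Fin 3 → K)),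
      p.Admissible → p.NoOverlap → q.Admissible → q.NoOverlap →
      p.IsRepOf τ → q.IsRepOf υ →
        (Nonempty (τ.Equiv υ) ↔ B3Form.SameUpToOrder p q)) := by
  have hrep : ∀ p : B3Form K, p.Admissible →
      ∃ τ : Representation K BraidGroup3 (Fin 3 → K), p.IsRepOf τ := fun p hp ↦
    exists_rep (B3Form.det_matA_ne_zero hp) (by
      rw [B3Form.det_matB hp]
      exact B3Form.det_matA_ne_zero hp) (B3Form.braid hp)
  refine ⟨fun V _ _ ρ hdim hind hmin ↦ ?_, fun p hp ↦ ?_, fun p q τ υ hp hp' hq hq' hτ hυ ↦ ?_⟩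
  · have : Module.Finite K V := Module.finite_of_finrank_pos (by omega)
    let e : V ≃ₗ[K] (Fin 3 → K) := LinearEquiv.ofFinrankEq _ _ (by simpa using hdim)
    obtain ⟨A, B, h⟩ := exists_hasMatrices ρ e
    obtain ⟨c, v, hv⟩ := h.minInvariantDim_one_iff.1 hmin
    obtain ⟨p, hp, hp', hpe⟩ := classified_of_eigenline
      ⟨h.braid, h.det_left_ne_zero, h.det_right_ne_zero, h.isIndecomposableRep_iff.1 hind.1⟩ hv
    obtain ⟨τ, hτ⟩ := hrep p hp
    exact ⟨p, τ, hp, hp', hτ, h.nonempty_equiv hτ.hasMatrices hpe⟩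
  · obtain ⟨τ, hτ⟩ := hrep p hp
    have h := hτ.hasMatrices
    have hv := B3Form.isEigenline_single (p := p)
    exact ⟨τ, hτ, ⟨h.isIndecomposableRep_iff.2 (B3Form.not_splits hp), h.not_isIrreducible hv⟩,
      h.minInvariantDim_one_iff.2 ⟨_, _, hv⟩⟩
  · constructor
    · rintro ⟨E⟩
      exact B3Form.sameUpToOrder_of_pairEquiv hp hp' hq hq'
        (hτ.hasMatrices.pairEquiv hυ.hasMatrices E)
    · intro h
      exact hτ.hasMatrices.nonempty_equiv hυ.hasMatrices
        (B3Form.pairEquiv_of_sameUpToOrder hp hp' hq h)
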